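/- Theorem (joint confidence set for $(\beta_1,\beta_2)$ in the partially permuted linear model). Let $X\in\mathbb R^{n\times p_1}$ and $Z\in\mathbb R^{n\times p_2}$ be fixed, put $p=p_1+p_2$, and consider the model $$Y=\Pi_0X\beta_{1,0}+Z\beta_{2,0}+\sigma_0U,\qquad U\sim N(0,I_n),\quad \sigma_0>0,$$ where $\Pi_0$ belongs to the set $\mathcal P_{n,k}$ of $n\times n$ permutation matrices $\Pi$ with $d(\Pi,I_n)=\#\{i:\Pi_{ii}=0\}\le k$, where $2\le k\le n$. For a matrix $A$ let $M_A$ be the orthogonal projection onto its range. Put $W(\Pi)=[\Pi X,\ Z]$, and assume that $W(\Pi_0)$ has full column rank $p$. Candidate set. Let $U_1^*,\dots,U_L^*$ be i.i.d. $N(0,I_n)$ and independent of $U$. For each $\ell$ let $\widehat\Pi_\ell\in\arg\min_{\Pi\in\mathcal P_{n,k}}\|(I_n-M_{(W(\Pi),U_\ell^*)})Y\|_2^2$ (any choice of minimizer), and let $\mathcal C^{(L)}_{\mathrm{partial}}=\{\widehat\Pi_1,\dots,\widehat\Pi_L\}$. Confidence set. With $r=Y-\Pi X\beta_1-Z\beta_2$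 let $$T(Y,(\Pi,\beta_1,\beta_2))=\frac{n-p}{p}\cdot\frac{r^\top M_{W(\Pi)}r}{r^\top(I_n-M_{W(\Pi)})r},$$ $$\Gamma_\alpha^{\mathrm{joint}}(Y)=\bigcup_{\Pi\in\mathcal C^{(L)}_{\mathrm{partial}}}\bigl\{(\beta_1,\beta_2)\in\mathbb R^{p_1+p_2}:\ T(Y,(\Pi,\beta_1,\beta_2))\le F^{-1}_{p,n-p}(\alpha)\bigr\},$$ where $F^{-1}_{p,n-p}$ is the quantile function of the $F$-distribution with $(p,n-p)$ degrees of freedom. Miscoverage bound. Let $$C=\min_{\Pi\in\mathcal P_{n,k},\,\Pi\ne\Pi_0}\frac{\|(I_n-M_{W(\Pi)})(\Pi_0X\beta_{1,0}+Z\beta_{2,0})\|_2^2}{n\max\{d(\Pi_0,I_n)-d(\Pi,I_n),\,1\}},\qquad \Psi(x)=x-1-\log x,$$ let $D_m$ be the number of derangements of $m$ elements, and for $\gamma\in(0,1/4]$ let $$\Delta(\gamma)=\sum_{m=n-k}^n\binom nm D_{n-m}\Bigl\{e^{-\frac n2\Psi\left(\max\left\{1,\frac{C\log(e/\gamma)}{2\sigma_0^2\gamma}\right\}\right)}+e^{-\frac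 n2\Psi\left(\max\left\{1,\frac{C\log^2(e/\gamma)}{16\sigma_0^2}\right\}\right)}\Bigr\}+\Bigl(\frac\pi2\Bigr)^{n-p-2}|\mathcal P_{n,k}|\Bigl(\gamma\log\frac e\gamma\Bigr)^{\frac{n-p-1}2}.$$ For $L\ge2$ put $$\gamma_L=\min\Bigl\{\frac14,\Bigl(\frac{(n-1)\log(eL)}{L}\Bigr)^{1/(n-1)}\Bigr\},\qquad \delta_L^{\mathrm{partial}}=\Delta(\gamma_L)+\Bigl(1-\frac{\gamma_L^{n-1}}{n-1}\Bigr)^L .$$ Claim. Suppose $C>0$ and $n>p+1$. Then for every $\alpha\in(0,1)$ and every $L\ge2$, $$\mathbb P_{(U_1^*,\dots,U_L^*,U)}\bigl((\beta_{1,0},\beta_{2,0})\in\Gamma_\alpha^{\mathrm{joint}}(Y)\bigr)\ \ge\ \alpha-\delta_L^{\mathrm{partial}},$$ and, as $L\to\infty$ with everything else fixed, $$\delta_L^{\mathrm{partial}}=O\Bigl(\frac{(\log L)^{(n-p)/2}}{L^{(n-p-1)/(2(n-1))}}\Bigr).$$ -/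

import Mathlib

open MeasureTheory ProbabilityTheory Filter Asymptotics
open scoped Matrix

namespace PermutedRegression

noncomputable section

/-! ### Permutations and projections -/

/-- The Hamming distance `d(Π, I_n) = ∑ i, 1{Π i i = 0}` of the permutation matrix of `π` to the
identity matrix. -/
def hammingId {n : ℕ} (π : Equiv.Perm (Fin n)) : ℕ :=
  ∑ i : Fin n, if π.permMatrix ℝ i i = 0 then 1 else 0

/-- The set `𝒫_{n,k}` of `k`-sparse permutations (a permutation stands for its matrix). -/
def sparsePerms (n k : ℕ) : Finset (Equiv.Perm (Fin n)) :=
  Finset.univ.filter fun π => hammingId π ≤ k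

/-- The range (column space) of a matrix with `n` rows, in Euclidean space. -/
def colSpace {n : ℕ} {ι : Type*} [Fintype ι] [DecidableEq ι] (A : Matrix (Fin n) ι ℝ) :
    Submodule ℝ (EuclideanSpace ℝ (Fin n)) :=
  LinearMap.range (Matrix.toEuclideanLin A)

/-- `M_A`, the orthogonal projection onto the range of `A`. It is `A (Aᵀ A)⁻¹ Aᵀ` when `A` has full
column rank. -/
def projM {n : ℕ} {ι : Type*} [Fintype ι] [DecidableEq ι] (A : Matrix (Fin n) ι ℝ) :
    EuclideanSpace ℝ (Fin n) →L[ℝ] EuclideanSpace ℝ (Fin n) :=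
  (colSpace A).starProjection

/-! ### The partially permuted model -/

/-- The expanded design matrix `W(Π) = [Π X, Z]`. -/
def design {n p₁ p₂ : ℕ} (X : Matrix (Fin n) (Fin p₁) ℝ) (Z : Matrix (Fin n) (Fin p₂) ℝ)
    (π : Equiv.Perm (Fin n)) : Matrix (Fin n) (Fin p₁ ⊕ Fin p₂) ℝ :=
  Matrix.fromCols (π.permMatrix ℝ * X) Z

/-- The vector `W(Π) (β₁, β₂) = Π X β₁ + Z β₂`. -/
def signal {n p₁ p₂ : ℕ} (X : Matrix (Fin n) (Fin p₁) ℝ) (Z : Matrix (Fin n) (Fin p₂) ℝ)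
    (π : Equiv.Perm (Fin n)) (β : (Fin p₁ → ℝ) × (Fin p₂ → ℝ)) : EuclideanSpace ℝ (Fin n) :=
  WithLp.toLp 2 (design X Z π *ᵥ Sum.elim β.1 β.2)

/-- The matrix `(W(Π), u)`, i.e. `W(Π)` augmented by the column `u`. -/
def augDesign {n p₁ p₂ : ℕ} (X : Matrix (Fin n) (Fin p₁) ℝ) (Z : Matrix (Fin n) (Fin p₂) ℝ)
    (π : Equiv.Perm (Fin n)) (u : EuclideanSpace ℝ (Fin n)) :
    Matrix (Fin n) ((Fin p₁ ⊕ Fin p₂) ⊕ Unit) ℝ :=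
  Matrix.fromCols (design X Z π) (Matrix.replicateCol Unit fun i => u i)

/-- The objective `‖(I_n - M_{(W(Π), u)}) y‖²` of the repro sample `u`. -/
def reproObjective {n p₁ p₂ : ℕ} (X : Matrix (Fin n) (Fin p₁) ℝ) (Z : Matrix (Fin n) (Fin p₂) ℝ)
    (y u : EuclideanSpace ℝ (Fin n)) (π : Equiv.Perm (Fin n)) : ℝ :=
  ‖y - projM (augDesign X Z π u) y‖ ^ 2

/-- The set of minimizers over `𝒫_{n,k}` of the objective of the repro sample `u`. -/
def reproArgmin {n p₁ p₂ : ℕ} (X : Matrix (Fin n) (Fin p₁) ℝ) (Z : Matrix (Fin n) (Fin p₂) ℝ)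
    (k : ℕ) (y u : EuclideanSpace ℝ (Fin n)) : Set (Equiv.Perm (Fin n)) :=
  {π | π ∈ sparsePerms n k ∧
    ∀ π' ∈ sparsePerms n k, reproObjective X Z y u π ≤ reproObjective X Z y u π'}

/-- The candidate set formed by the `L` computed minimizers `Πhat 1, …, Πhat L`. -/
def candidateSet {n L : ℕ} (k : ℕ) (πhat : Fin L → Equiv.Perm (Fin n)) :
    Set (Equiv.Perm (Fin n)) :=
  {π | π ∈ sparsePerms n k ∧ ∃ ℓ, πhat ℓ = π}

/-! ### The `F` distribution and the confidence set -/

/-- The chi-squared distribution with `d` degrees of freedom: the law of the squared norm of a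
standard Gaussian vector in dimension `d`. -/
def chiSquared (d : ℕ) : Measure ℝ :=
  (stdGaussian (EuclideanSpace ℝ (Fin d))).map fun x => ‖x‖ ^ 2

/-- The `F_{a,b}` distribution: the law of `(A / a) / (B / b)` for independent `A ∼ χ²_a` and
`B ∼ χ²_b`. -/
def fDist (a b : ℕ) : Measure ℝ :=
  ((chiSquared a).prod (chiSquared b)).map fun x => (x.1 / a) / (x.2 / b)

/-- The quantile function `q ↦ inf {x : q ≤ F(x)}` of a law on `ℝ` with distribution function `F`,
for `0 < q < 1`. -/
def quantile (ν : Measure ℝ) (q : ℝ) : ℝ :=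
  sInf {x : ℝ | q ≤ cdf ν x}

/-- The statistic
`T(y, (Π, β₁, β₂)) = ((n - p) / p) * (rᵀ M_{W(Π)} r) / (rᵀ (I_n - M_{W(Π)}) r)` with
`r = y - W(Π) (β₁, β₂)` and `p = p₁ + p₂`. -/
def jointStat {n p₁ p₂ : ℕ} (X : Matrix (Fin n) (Fin p₁) ℝ) (Z : Matrix (Fin n) (Fin p₂) ℝ)
    (y : EuclideanSpace ℝ (Fin n)) (π : Equiv.Perm (Fin n))
    (β : (Fin p₁ → ℝ) × (Fin p₂ → ℝ)) : ℝ :=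
  let r := y - signal X Z π β
  let M := projM (design X Z π)
  ((n : ℝ) - ((p₁ : ℝ) + p₂)) / ((p₁ : ℝ) + p₂) * (inner ℝ r (M r) / inner ℝ r (r - M r))

/-- The joint confidence set: the union over the candidates `Π ∈ C` of the level-`α` regions
`{(β₁, β₂) : T(y, (Π, β₁, β₂)) ≤ F⁻¹_{p, n - p}(α)}`. -/
def jointConfidenceSet {n p₁ p₂ : ℕ} (X : Matrix (Fin n) (Fin p₁) ℝ)
    (Z : Matrix (Fin n) (Fin p₂) ℝ) (α : ℝ) (C : Set (Equiv.Perm (Fin n)))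
    (y : EuclideanSpace ℝ (Fin n)) : Set ((Fin p₁ → ℝ) × (Fin p₂ → ℝ)) :=
  ⋃ π ∈ C, {β | jointStat X Z y π β ≤ quantile (fDist (p₁ + p₂) (n - (p₁ + p₂))) α}

/-! ### The miscoverage bound -/

/-- The separation constant: the minimum over `Π ∈ 𝒫_{n,k}`, `Π ≠ Π₀`, of
`‖(I_n - M_{W(Π)}) W(Π₀) (β₁, β₂)‖² / (n max (d(Π₀, I_n) - d(Π, I_n), 1))`.
(If there is no such `Π`, this is `0`.) -/
def cMin {n p₁ p₂ : ℕ} (X : Matrix (Fin n) (Fin p₁) ℝ) (Z : Matrix (Fin n) (Fin p₂) ℝ)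
    (k : ℕ) (π₀ : Equiv.Perm (Fin n)) (β : (Fin p₁ → ℝ) × (Fin p₂ → ℝ)) : ℝ :=
  ⨅ π : {π : Equiv.Perm (Fin n) // π ∈ sparsePerms n k ∧ π ≠ π₀},
    ‖signal X Z π₀ β - projM (design X Z π.1) (signal X Z π₀ β)‖ ^ 2 /
      (n * max ((hammingId π₀ : ℝ) - hammingId π.1) 1)

/-- `Ψ(x) = x - 1 - log x`. -/
def psi (x : ℝ) : ℝ := x - 1 - Real.log x

/-- The quantity `Δ(γ)` for sample size `n`, sparsity `k`, total dimension `p`, separation constant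
`c` and noise level `σ`; `numDerangements m` is the number of derangements of `m` elements. -/
def deltaGamma (n k p : ℕ) (c σ γ : ℝ) : ℝ :=
  (∑ m ∈ Finset.Icc (n - k) n, (n.choose m : ℝ) * (numDerangements (n - m) : ℝ) *
    (Real.exp (-((n : ℝ) / 2) *
        psi (max 1 (c * Real.log (Real.exp 1 / γ) / (2 * σ ^ 2 * γ)))) +
      Real.exp (-((n : ℝ) / 2) *
        psi (max 1 (c * Real.log (Real.exp 1 / γ) ^ 2 / (16 * σ ^ 2)))))) +
  (Real.pi / 2) ^ (n - p - 2) * ((sparsePerms n k).card : ℝ) *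
    (γ * Real.log (Real.exp 1 / γ)) ^ (((n : ℝ) - p - 1) / 2)

/-- `γ_L = min {1/4, ((n - 1) log (e L) / L) ^ (1 / (n - 1))}`. -/
def gammaL (n L : ℕ) : ℝ :=
  min (1 / 4) ((((n : ℝ) - 1) * Real.log (Real.exp 1 * L) / L) ^ (1 / ((n : ℝ) - 1)))

/-- `δ_L = Δ(γ_L) + (1 - γ_L ^ (n - 1) / (n - 1)) ^ L`. -/
def deltaL (n k p : ℕ) (c σ : ℝ) (L : ℕ) : ℝ :=
  deltaGamma n k p c σ (gammaL n L) + (1 - gammaL n L ^ (n - 1) / ((n : ℝ) - 1)) ^ L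

end

end PermutedRegression

open PermutedRegression

/-! A repro sample u nearly parallel to the noise v reveals Π₀: as an extra column it absorbs almost
all the noise, so the fit with Π₀ leaves a residual of at most σγ‖v‖, where γ bounds the sine of the
angle. A wrong Π leaves at least ε‖g‖ − σγ‖v‖, g being the part of the signal orthogonal to the
range of W(Π), unless u itself is aligned with g up to sine ε once that range is projected out. For
ε = γ log(e/γ)/2, the constant C forces every minimizer to be Π₀ as soon as ‖v‖² < nC
log²(e/γ)/(16σ²) (`eq_of_mem_reproArgmin`, `mem_jointConfidenceSet_of_event`).

It remains to bound three failures. A large ‖v‖ is a chi-squared tail (`stdGaussian_norm_sq_ge_le`).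
The absence of a sample that is both close to v and unaligned costs (1 − q)^L plus the probability
of alignment, without a factor L (`measureReal_no_good_close_le`). The statistic at the true
parameter has exactly the F law, hence exceeds its quantile with probability at most 1 − α
(`le_measureReal_jointStat_le`). Angle probabilities reduce to a Gaussian cone, whose measure is
compared with powers of the sine and the tangent (`le_coneProb`, `coneProb_le_pow`).

For the rate, every term of δ_L is O(1/L) except the power of γ log(e/γ), which gives the stated
order. -/

namespace PermutedRegression

/-! ### Independence and chi-squared laws of Gaussian projections. -/

section GaussianProjections

variable {E : Type*} [NormedAddCommGroup E] [InnerProductSpace ℝ E] [FiniteDimensional ℝ E]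
  [MeasurableSpace E] [BorelSpace E]

lemma stdGaussian_map_norm_sq :
    (stdGaussian E).map (fun x => ‖x‖ ^ 2) = chiSquared (Module.finrank ℝ E) := by
  rw [chiSquared, ← stdGaussian_map (stdOrthonormalBasis ℝ E).repr,
    Measure.map_map (by fun_prop) (by fun_prop)]
  congr 1
  ext x
  simp

/-- Pairing the two projections of x with (s, t) gives ⟨x, s + t⟩, and by Pythagoras exp(−‖s +
t‖²/2) factors, so the joint characteristic function is a product. -/
lemma stdGaussian_map_orthogonalProjectionOnto_prod {S T : Submodule ℝ E} (h : S ⟂ T) :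
    (stdGaussian E).map (fun x => (S.orthogonalProjectionOnto x, T.orthogonalProjectionOnto x)) =
      (stdGaussian S).prod (stdGaussian T) := by
  have hS : Measurable (fun x : E => S.orthogonalProjectionOnto x) :=
    S.orthogonalProjectionOnto.continuous.measurable
  have hT : Measurable (fun x : E => T.orthogonalProjectionOnto x) :=
    T.orthogonalProjectionOnto.continuous.measurable
  have : IsProbabilityMeasure ((stdGaussian E).map
      (fun x => (S.orthogonalProjectionOnto x, T.orthogonalProjectionOnto x))) :=
    Measure.isProbabilityMeasure_map (hS.prodMk hT).aemeasurable
  rw [← charFun_eq_prod_iff]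
  intro t
  have key : charFun (stdGaussian E) ((t.fst : E) + (t.snd : E)) =
      charFun (((stdGaussian E).map (fun x =>
        (S.orthogonalProjectionOnto x, T.orthogonalProjectionOnto x))).map (WithLp.toLp 2)) t := by
    rw [charFun_apply, charFun_apply, integral_map (by fun_prop) (by fun_prop),
      integral_map (hS.prodMk hT).aemeasurable (by fun_prop)]
    refine integral_congr_ae (ae_of_all _ fun x => ?_)
    simp [WithLp.prod_inner_apply, inner_add_right]
  have hort : inner ℝ (t.fst : E) (t.snd : E) = 0 := h.inner_eq t.fst.2 t.snd.2
  rw [← key, charFun_stdGaussian, charFun_stdGaussian, charFun_stdGaussian, ← Complex.exp_add]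
  congr 1
  have h2 : ‖(t.fst : E) + (t.snd : E)‖ ^ 2 = ‖t.fst‖ ^ 2 + ‖t.snd‖ ^ 2 := by
    rw [norm_add_sq_real, hort]; simp
  rw [← Complex.ofReal_pow, h2]
  push_cast
  simp only [WithLp.ofLp_fst, WithLp.ofLp_snd]
  ring

lemma stdGaussian_map_norm_sq_prod {S T : Submodule ℝ E} (h : S ⟂ T) :
    (stdGaussian E).map (fun x => (‖S.starProjection x‖ ^ 2, ‖T.starProjection x‖ ^ 2)) =
      (chiSquared (Module.finrank ℝ S)).prod (chiSquared (Module.finrank ℝ T)) := by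
  rw [← stdGaussian_map_norm_sq, ← stdGaussian_map_norm_sq,
    Measure.map_prod_map _ _ (by fun_prop) (by fun_prop),
    ← stdGaussian_map_orthogonalProjectionOnto_prod h, Measure.map_map (by fun_prop)]
  · rfl
  · exact S.orthogonalProjectionOnto.continuous.measurable.prodMk
      T.orthogonalProjectionOnto.continuous.measurable

end GaussianProjections

/-! ### Gaussian density and chi-squared tail. -/

section GaussianDensity

/-- The density of the standard Gaussian law with respect to the volume. -/
noncomputable def stdGaussianDensity (E : Type*) [NormedAddCommGroup E] [InnerProductSpace ℝ E]
    (x : E) : ℝ :=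
  (2 * Real.pi) ^ (-(Module.finrank ℝ E : ℝ) / 2) * Real.exp (-(1 / 2) * ‖x‖ ^ 2)

lemma stdGaussianDensity_nonneg {E : Type*} [NormedAddCommGroup E] [InnerProductSpace ℝ E] (x : E) :
    0 ≤ stdGaussianDensity E x := by
  unfold stdGaussianDensity; positivity

@[fun_prop]
lemma measurable_stdGaussianDensity {E : Type*} [NormedAddCommGroup E] [InnerProductSpace ℝ E]
    [MeasurableSpace E] [BorelSpace E] : Measurable (stdGaussianDensity E) := by
  unfold stdGaussianDensity; fun_prop

variable {E : Type*} [NormedAddCommGroup E] [InnerProductSpace ℝ E] [FiniteDimensional ℝ E]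
  [MeasurableSpace E] [BorelSpace E]

lemma integrable_exp_neg_mul_norm_sq {b : ℝ} (hb : 0 < b) :
    Integrable (fun x : E => Real.exp (-b * ‖x‖ ^ 2)) := by
  -- A non-integrable function has integral 0 by convention, against the positive value of the
  -- Gaussian integral.
  by_contra h
  have h1 := GaussianFourier.integral_rexp_neg_mul_sq_norm (V := E) hb
  rw [integral_undef h] at h1
  have : 0 < (Real.pi / b) ^ ((Module.finrank ℝ E : ℝ) / 2) := by positivity
  linarith

lemma stdGaussian_eq_withDensity :
    stdGaussian E = volume.withDensity (fun x => ENNReal.ofReal (stdGaussianDensity E x)) := by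
  have hint : Integrable (stdGaussianDensity E) := by
    unfold stdGaussianDensity
    exact (integrable_exp_neg_mul_norm_sq (by norm_num)).const_mul _
  have : IsFiniteMeasure
      (volume.withDensity (fun x : E => ENNReal.ofReal (stdGaussianDensity E x))) :=
    isFiniteMeasure_withDensity_ofReal hint.2
  apply Measure.ext_of_charFun
  ext t
  rw [charFun_stdGaussian, charFun_apply, integral_withDensity_eq_integral_toReal_smul
    (by fun_prop) (by simp)]
  have h1 := GaussianFourier.integral_cexp_neg_mul_sq_norm_add (V := E) (b := (1 / 2 : ℂ))
    (by norm_num) Complex.I t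
  have h2 : ∀ x : E, (ENNReal.ofReal (stdGaussianDensity E x)).toReal •
      Complex.exp (inner ℝ x t * Complex.I) =
      ((2 * Real.pi : ℝ) ^ (-(Module.finrank ℝ E : ℝ) / 2) : ℝ) *
        Complex.exp (-(1 / 2) * ‖x‖ ^ 2 + Complex.I * inner ℝ t x) := by
    intro x
    rw [ENNReal.toReal_ofReal (stdGaussianDensity_nonneg x), stdGaussianDensity, Complex.exp_add,
      real_inner_comm x t, mul_comm Complex.I, Complex.real_smul]
    push_cast
    ring
  simp_rw [h2]
  rw [integral_const_mul, h1]
  have h3 : ((2 * Real.pi : ℝ) ^ (-(Module.finrank ℝ E : ℝ) / 2) : ℝ) *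
      (Real.pi / (1 / 2) : ℂ) ^ ((Module.finrank ℝ E : ℂ) / 2) = 1 := by
    have : (Real.pi / (1 / 2) : ℂ) = ((2 * Real.pi : ℝ) : ℂ) := by push_cast; ring
    rw [this, show ((Module.finrank ℝ E : ℂ) / 2) = (((Module.finrank ℝ E : ℝ) / 2 : ℝ) : ℂ) by
      push_cast; ring, ← Complex.ofReal_cpow (by positivity), ← Complex.ofReal_mul, neg_div,
      Real.rpow_neg (by positivity), inv_mul_cancel₀ (by positivity), Complex.ofReal_one]
  rw [← mul_assoc, h3, one_mul, Complex.I_sq]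
  congr 1
  ring

lemma stdGaussian_ae_ne_zero [Nontrivial E] : ∀ᵐ x ∂(stdGaussian E), x ≠ 0 := by
  rw [stdGaussian_eq_withDensity]
  exact (withDensity_absolutelyContinuous _ _).ae_le (Measure.ae_ne volume 0)

/-- The Chernoff bound for the upper tail of the chi-squared distribution. -/
lemma stdGaussian_norm_sq_ge_le [Nontrivial E] (x : ℝ) :
    (stdGaussian E).real {u | Module.finrank ℝ E * x ≤ ‖u‖ ^ 2} ≤
      Real.exp (-((Module.finrank ℝ E : ℝ) / 2) * psi (max 1 x)) := by
  set d : ℝ := (Module.finrank ℝ E : ℝ)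
  rcases le_or_gt x 1 with hx | hx
  · rw [max_eq_left hx]
    simp [psi]
  rw [max_eq_right hx.le]
  have hx0 : 0 < x := by linarith
  -- The optimal Chernoff exponent: 1 − 2t = 1/x, so the moment generating function (1 − 2t)^(−d/2)
  -- equals x^(d/2).
  set t : ℝ := (1 - 1 / x) / 2 with ht
  have ht0 : 0 ≤ t := by
    have : 1 / x ≤ 1 := by rw [div_le_one hx0]; exact hx.le
    rw [ht]; linarith
  have hb : 1 / 2 - t = 1 / (2 * x) := by rw [ht]; field_simp; ring
  have hbpos : 0 < 1 / 2 - t := by rw [hb]; positivity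
  have hfun : ∀ u : E, (ENNReal.ofReal (stdGaussianDensity E u)).toReal • Real.exp (t * ‖u‖ ^ 2)
      = (2 * Real.pi) ^ (-d / 2) * Real.exp (-(1 / 2 - t) * ‖u‖ ^ 2) := by
    intro u
    rw [ENNReal.toReal_ofReal (stdGaussianDensity_nonneg u), stdGaussianDensity, smul_eq_mul,
      mul_assoc, ← Real.exp_add]
    congr 2
    ring
  have hint : Integrable (fun u : E => Real.exp (t * ‖u‖ ^ 2)) (stdGaussian E) := by
    rw [stdGaussian_eq_withDensity, integrable_withDensity_iff_integrable_smul' (by fun_prop)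
      (by simp)]
    simp_rw [hfun]
    exact (integrable_exp_neg_mul_norm_sq hbpos).const_mul _
  have hmgf : mgf (fun u : E => ‖u‖ ^ 2) (stdGaussian E) t = x ^ (d / 2) := by
    rw [mgf, stdGaussian_eq_withDensity, integral_withDensity_eq_integral_toReal_smul
      (by fun_prop) (by simp)]
    simp_rw [hfun]
    rw [integral_const_mul, GaussianFourier.integral_rexp_neg_mul_sq_norm hbpos, hb,
      show Real.pi / (1 / (2 * x)) = 2 * Real.pi * x by field_simp,
      Real.mul_rpow (by positivity) hx0.le, neg_div, Real.rpow_neg (by positivity), ← mul_assoc,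
      inv_mul_cancel₀ (by positivity), one_mul]
  refine (measure_ge_le_exp_mul_mgf (X := fun u : E => ‖u‖ ^ 2) (d * x) ht0 hint).trans_eq ?_
  rw [hmgf, Real.rpow_def_of_pos hx0, ← Real.exp_add, psi, ht]
  congr 1
  field_simp
  ring

end GaussianDensity

/-! ### The Gaussian measure of a cone through the Cauchy law. -/

section Cone

open scoped ENNReal

lemma lintegral_comp_smul {E : Type*} [NormedAddCommGroup E] [NormedSpace ℝ E] [MeasurableSpace E]
    [BorelSpace E] [FiniteDimensional ℝ E] (μ : Measure E) [μ.IsAddHaarMeasure] {f : E → ℝ≥0∞}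
    (hf : Measurable f) {R : ℝ} (hR : R ≠ 0) :
    ∫⁻ x, f (R • x) ∂μ = ENNReal.ofReal |(R ^ Module.finrank ℝ E)⁻¹| * ∫⁻ x, f x ∂μ := by
  rw [← lintegral_map (f := f) hf (measurable_const_smul R), Measure.map_addHaar_smul μ hR,
    lintegral_smul_measure, smul_eq_mul]

/-- The weight `(1 + ρ²) ^ (-(d + 1) / 2)` of the `d`-dimensional Cauchy density. -/
noncomputable def cauchyWeight (d : ℕ) (ρ : ℝ) : ℝ := (√(1 + ρ ^ 2) ^ (d + 1))⁻¹

lemma cauchyWeight_nonneg (d : ℕ) (ρ : ℝ) : 0 ≤ cauchyWeight d ρ := by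
  unfold cauchyWeight; positivity

@[fun_prop]
lemma measurable_cauchyWeight (d : ℕ) : Measurable (cauchyWeight d) := by
  unfold cauchyWeight; fun_prop

/-- The ratio of a standard Gaussian vector and the modulus of an independent standard Gaussian
variable has a Cauchy distribution. -/
lemma exists_lintegral_gaussian_ratio (F : Type*) [NormedAddCommGroup F] [InnerProductSpace ℝ F]
    [FiniteDimensional ℝ F] [MeasurableSpace F] [BorelSpace F] :
    ∃ C : ℝ≥0∞, ∀ g : F → ℝ≥0∞, Measurable g →
      ∫⁻ a, ∫⁻ x, g (|a|⁻¹ • x) ∂(stdGaussian F) ∂(stdGaussian ℝ) =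
        C * ∫⁻ y, g y * ENNReal.ofReal (cauchyWeight (Module.finrank ℝ F) ‖y‖) := by
  set d := Module.finrank ℝ F with hd
  set k : ℝ := (2 * Real.pi) ^ (-(1 : ℝ) / 2) * (2 * Real.pi) ^ (-(d : ℝ) / 2) with hk
  set H : ℝ → ℝ := fun a => k * |a| ^ d * Real.exp (-(1 / 2) * a ^ 2) with hH
  have hHm : Measurable H := by rw [hH]; fun_prop
  refine ⟨∫⁻ a, ENNReal.ofReal (H a), fun g hg => ?_⟩
  have hinner : ∀ a : ℝ, a ≠ 0 → ∫⁻ x, g (|a|⁻¹ • x) ∂(stdGaussian F) =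
      ENNReal.ofReal (|a| ^ d) * ∫⁻ y, g y * ENNReal.ofReal (stdGaussianDensity F (|a| • y)) := by
    intro a ha
    have ha' : |a| ≠ 0 := abs_ne_zero.mpr ha
    rw [stdGaussian_eq_withDensity, lintegral_withDensity_eq_lintegral_mul _ (by fun_prop)
      (by fun_prop)]
    have h1 := lintegral_comp_smul (volume : Measure F)
      (f := fun y => g y * ENNReal.ofReal (stdGaussianDensity F (|a| • y))) (by fun_prop)
      (inv_ne_zero ha')
    simp only [smul_inv_smul₀ ha', inv_pow, inv_inv, ← hd] at h1
    rw [abs_of_nonneg (by positivity : (0 : ℝ) ≤ |a| ^ d)] at h1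
    rw [← h1]
    refine lintegral_congr fun x => ?_
    simp [mul_comm]
  -- The two exponents add up to −a²(1 + ‖y‖²)/2, so for fixed y the integrand in a is a rescaling
  -- of one function `H`. After Tonelli the scaling produces the last factor of the Cauchy weight,
  -- and the integral of `H` never has to be evaluated.
  have hcomb : ∀ (a : ℝ) (y : F), stdGaussianDensity ℝ a * (|a| ^ d *
      stdGaussianDensity F (|a| • y)) =
      (√(1 + ‖y‖ ^ 2) ^ d)⁻¹ * H (√(1 + ‖y‖ ^ 2) • a) := by
    intro a y
    have hs : √(1 + ‖y‖ ^ 2) ≠ 0 := by positivity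
    have hsq : √(1 + ‖y‖ ^ 2) ^ 2 = 1 + ‖y‖ ^ 2 := Real.sq_sqrt (by positivity)
    have he : Real.exp (-(1 / 2) * (√(1 + ‖y‖ ^ 2) * a) ^ 2) =
        Real.exp (-(1 / 2) * a ^ 2) * Real.exp (-(1 / 2) * (|a| * ‖y‖) ^ 2) := by
      rw [← Real.exp_add, mul_pow, hsq, mul_pow, sq_abs]; congr 1; ring
    rw [hH]
    simp only [stdGaussianDensity, smul_eq_mul, norm_smul, Real.norm_eq_abs, abs_abs, sq_abs, ← hd,
      abs_mul, abs_of_nonneg (Real.sqrt_nonneg _), he, mul_pow _ _ d, hk, Module.finrank_self,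
      Nat.cast_one]
    field_simp
  calc ∫⁻ a, ∫⁻ x, g (|a|⁻¹ • x) ∂(stdGaussian F) ∂(stdGaussian ℝ)
      = ∫⁻ a, ENNReal.ofReal (|a| ^ d) *
          (∫⁻ y, g y * ENNReal.ofReal (stdGaussianDensity F (|a| • y))) ∂(stdGaussian ℝ) := by
        refine lintegral_congr_ae ?_
        filter_upwards [stdGaussian_ae_ne_zero (E := ℝ)] with a ha using hinner a ha
    _ = ∫⁻ a, ∫⁻ y, g y * ENNReal.ofReal ((√(1 + ‖y‖ ^ 2) ^ d)⁻¹ * H (√(1 + ‖y‖ ^ 2) • a)) := by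
        rw [stdGaussian_eq_withDensity (E := ℝ), lintegral_withDensity_eq_lintegral_mul _
          (by fun_prop)]
        · refine lintegral_congr fun a => ?_
          simp only [Pi.mul_apply]
          rw [← mul_assoc, ← lintegral_const_mul _ (by fun_prop)]
          refine lintegral_congr fun y => ?_
          rw [← hcomb, ENNReal.ofReal_mul (stdGaussianDensity_nonneg a),
            ENNReal.ofReal_mul (by positivity)]
          ring
        · refine Measurable.mul (by fun_prop)
            (Measurable.lintegral_prod_right' (f := fun p : ℝ × F =>
            g p.2 * ENNReal.ofReal (stdGaussianDensity F (|p.1| • p.2))) (by fun_prop))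
    _ = ∫⁻ y, ∫⁻ a, g y * ENNReal.ofReal ((√(1 + ‖y‖ ^ 2) ^ d)⁻¹ * H (√(1 + ‖y‖ ^ 2) • a)) := by
        refine lintegral_lintegral_swap ?_
        apply Measurable.aemeasurable
        simp only [Function.uncurry_def]
        fun_prop
    _ = ∫⁻ y, (∫⁻ a, ENNReal.ofReal (H a)) * (g y * ENNReal.ofReal (cauchyWeight d ‖y‖)) := by
        refine lintegral_congr fun y => ?_
        have hs : √(1 + ‖y‖ ^ 2) ≠ 0 := by positivity
        rw [lintegral_const_mul _ (by fun_prop)]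
        simp_rw [ENNReal.ofReal_mul (by positivity : (0 : ℝ) ≤ (√(1 + ‖y‖ ^ 2) ^ d)⁻¹)]
        rw [lintegral_const_mul _ (by fun_prop), lintegral_comp_smul volume
          (f := fun a => ENNReal.ofReal (H a)) (by fun_prop) hs, Module.finrank_self, pow_one,
          abs_of_nonneg (by positivity), cauchyWeight, pow_succ _ d, mul_inv,
          ENNReal.ofReal_mul (by positivity)]
        ring
    _ = _ := lintegral_const_mul _ (by fun_prop)

/-- The Gaussian measure of the cone `{(a, x) : ‖x‖ ≤ r |a|}`. -/
noncomputable def coneProb (F : Type*) [NormedAddCommGroup F] [InnerProductSpace ℝ F]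
    [FiniteDimensional ℝ F] [MeasurableSpace F] (r : ℝ) : ℝ :=
  ((stdGaussian ℝ).prod (stdGaussian F)).real {p | ‖p.2‖ ≤ r * |p.1|}

/-- Polar coordinates turn the Cauchy law into a radial density. The constant K stays implicit: the
normalization to total mass 1 is all that is needed to bound it on both sides. -/
lemma exists_coneProb_eq (F : Type*) [NormedAddCommGroup F] [InnerProductSpace ℝ F]
    [FiniteDimensional ℝ F] [MeasurableSpace F] [BorelSpace F] [Nontrivial F] :
    ∃ K : ℝ, 0 ≤ K ∧
      (K * ∫ ρ in Set.Ioi (0 : ℝ), ρ ^ (Module.finrank ℝ F - 1) *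
        cauchyWeight (Module.finrank ℝ F) ρ = 1) ∧
      ∀ r, 0 ≤ r → coneProb F r = K * ∫ ρ in Set.Ioc 0 r, ρ ^ (Module.finrank ℝ F - 1) *
        cauchyWeight (Module.finrank ℝ F) ρ := by
  obtain ⟨C, hC⟩ := exists_lintegral_gaussian_ratio F
  set d := Module.finrank ℝ F with hd
  have key : ∀ g : ℝ → ℝ, Measurable g → (∀ ρ, 0 ≤ g ρ) →
      (∫⁻ a, ∫⁻ x, ENNReal.ofReal (g ‖|a|⁻¹ • x‖) ∂(stdGaussian F) ∂(stdGaussian ℝ)).toReal =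
      C.toReal * (d * (volume : Measure F).real (Metric.ball 0 1)) *
        ∫ ρ in Set.Ioi (0 : ℝ), ρ ^ (d - 1) * (g ρ * cauchyWeight d ρ) := by
    intro g hg hg0
    rw [hC (fun y => ENNReal.ofReal (g ‖y‖)) (by fun_prop), ENNReal.toReal_mul]
    have h1 := integral_fun_norm_addHaar (volume : Measure F) (fun ρ => g ρ * cauchyWeight d ρ)
    rw [integral_eq_lintegral_of_nonneg_ae
      (ae_of_all _ fun y => mul_nonneg (hg0 _) (cauchyWeight_nonneg _ _))
      (by fun_prop)] at h1
    simp_rw [← ENNReal.ofReal_mul (hg0 _)]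
    rw [h1]
    simp only [smul_eq_mul, nsmul_eq_mul, ← hd]
    ring
  refine ⟨C.toReal * (d * (volume : Measure F).real (Metric.ball 0 1)), by positivity, ?_, ?_⟩
  · have := key (fun _ => 1) (by fun_prop) (by simp)
    simpa using this.symm
  · intro r hr
    have := key ((Set.Iic r).indicator 1) (measurable_one.indicator measurableSet_Iic)
      (fun ρ => Set.indicator_nonneg (by simp) _)
    have hset : ∫ ρ in Set.Ioi (0 : ℝ), ρ ^ (d - 1) * ((Set.Iic r).indicator 1 ρ * cauchyWeight d ρ)
        = ∫ ρ in Set.Ioc 0 r, ρ ^ (d - 1) * cauchyWeight d ρ := by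
      rw [← Set.Ioi_inter_Iic, ← setIntegral_indicator measurableSet_Iic]
      refine setIntegral_congr_fun measurableSet_Ioi fun ρ _ => ?_
      by_cases h : ρ ∈ Set.Iic r <;> simp [h]
    rw [hset] at this
    rw [← this, coneProb, measureReal_def, Measure.prod_apply
      (measurableSet_le (by fun_prop) (by fun_prop))]
    congr 1
    refine lintegral_congr_ae ?_
    filter_upwards [stdGaussian_ae_ne_zero (E := ℝ)] with a ha
    have hm : MeasurableSet {x : F | ‖x‖ ≤ r * |a|} :=
      measurableSet_le (by fun_prop) (by fun_prop)
    change stdGaussian F {x : F | ‖x‖ ≤ r * |a|} = _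
    rw [← lintegral_indicator_one hm]
    refine lintegral_congr fun x => ?_
    have : ‖|a|⁻¹ • x‖ ≤ r ↔ ‖x‖ ≤ r * |a| := by
      rw [norm_smul, norm_inv, Real.norm_eq_abs, abs_abs, inv_mul_le_iff₀ (abs_pos.mpr ha),
        mul_comm]
    by_cases h : ‖x‖ ≤ r * |a|
    · rw [Set.indicator_of_mem (by simpa using h), Set.indicator_of_mem (by simpa [this] using h)]
      simp
    · rw [Set.indicator_of_notMem (by simpa using h),
        Set.indicator_of_notMem (by simpa only [Set.mem_Iic, this] using h)]
      simp

end Cone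

/-! ### Upper and lower bounds for the cone probability. -/

section ConeBounds

lemma hasDerivAt_div_sqrt_one_add_sq (ρ : ℝ) :
    HasDerivAt (fun ρ : ℝ => ρ / √(1 + ρ ^ 2)) (1 / √(1 + ρ ^ 2) ^ 3) ρ := by
  have hpos : (0 : ℝ) < 1 + ρ ^ 2 := by positivity
  have h1 : HasDerivAt (fun ρ : ℝ => √(1 + ρ ^ 2)) (ρ / √(1 + ρ ^ 2)) ρ := by
    have := (((hasDerivAt_id ρ).pow 2).const_add 1).sqrt hpos.ne'
    refine this.congr_deriv ?_
    simp only [id, Nat.cast_ofNat, Pi.pow_apply]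
    ring
  refine ((hasDerivAt_id ρ).div h1 (by positivity)).congr_deriv ?_
  have hs : √(1 + ρ ^ 2) ^ 2 = 1 + ρ ^ 2 := Real.sq_sqrt hpos.le
  simp only [id]
  field_simp
  rw [hs]; ring

/-- With ρ the tangent of an angle, ρ/√(1 + ρ²) is its sine. This derivative is the radial Cauchy
density with one extra factor (1 + ρ²)^(−1/2), hence an explicit minorant of it. -/
lemma hasDerivAt_sine_pow {d : ℕ} (hd : d ≠ 0) (ρ : ℝ) :
    HasDerivAt (fun ρ : ℝ => (ρ / √(1 + ρ ^ 2)) ^ d / d)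
      (ρ ^ (d - 1) * (√(1 + ρ ^ 2) ^ (d + 2))⁻¹) ρ := by
  refine (((hasDerivAt_div_sqrt_one_add_sq ρ).pow d).div_const (d : ℝ)).congr_deriv ?_
  have hpos : (0 : ℝ) < √(1 + ρ ^ 2) := by positivity
  have : (d : ℝ) ≠ 0 := by exact_mod_cast hd
  obtain ⟨m, rfl⟩ := Nat.exists_eq_succ_of_ne_zero hd
  simp only [Nat.succ_eq_add_one, Nat.add_sub_cancel, div_pow]
  field_simp
  ring

lemma tendsto_div_sqrt_one_add_sq :
    Tendsto (fun ρ : ℝ => ρ / √(1 + ρ ^ 2)) atTop (nhds 1) := by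
  have h1 : Tendsto (fun ρ : ℝ => 1 / √(1 / ρ ^ 2 + 1)) atTop (nhds (1 / √(0 + 1))) := by
    refine Tendsto.div tendsto_const_nhds ?_ (by simp)
    refine (Real.continuous_sqrt.tendsto _).comp (Tendsto.add ?_ tendsto_const_nhds)
    simpa using (tendsto_pow_neg_atTop (𝕜 := ℝ) (n := 2) (by norm_num))
  simp only [zero_add, Real.sqrt_one, div_one] at h1
  refine h1.congr' ?_
  filter_upwards [eventually_gt_atTop 0] with ρ hρ
  have : 1 + ρ ^ 2 = ρ ^ 2 * (1 / ρ ^ 2 + 1) := by field_simp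
  rw [this, Real.sqrt_mul (by positivity), Real.sqrt_sq hρ.le]
  field_simp

lemma one_le_sqrt_one_add_sq (ρ : ℝ) : 1 ≤ √(1 + ρ ^ 2) := by
  rw [Real.one_le_sqrt]; nlinarith [sq_nonneg ρ]

lemma sine_weight_le {d : ℕ} {ρ : ℝ} (hρ : 0 ≤ ρ) :
    ρ ^ (d - 1) * (√(1 + ρ ^ 2) ^ (d + 2))⁻¹ ≤ ρ ^ (d - 1) * cauchyWeight d ρ := by
  unfold cauchyWeight
  have := one_le_sqrt_one_add_sq ρ
  gcongr 2
  exact pow_le_pow_right₀ this (by omega)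

lemma one_div_le_integral_cauchyWeight {d : ℕ} (hd : d ≠ 0)
    (hint : IntegrableOn (fun ρ => ρ ^ (d - 1) * cauchyWeight d ρ) (Set.Ioi 0)) :
    1 / (d : ℝ) ≤ ∫ ρ in Set.Ioi (0 : ℝ), ρ ^ (d - 1) * cauchyWeight d ρ := by
  have hlim : Tendsto (fun ρ : ℝ => (ρ / √(1 + ρ ^ 2)) ^ d / d) atTop (nhds (1 ^ d / d)) :=
    (tendsto_div_sqrt_one_add_sq.pow d).div_const _
  have hnn : ∀ ρ ∈ Set.Ioi (0 : ℝ), 0 ≤ ρ ^ (d - 1) * (√(1 + ρ ^ 2) ^ (d + 2))⁻¹ := by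
    intro ρ hρ
    have : (0 : ℝ) < ρ := hρ
    positivity
  have h1 := integral_Ioi_of_hasDerivAt_of_nonneg' (fun ρ _ => hasDerivAt_sine_pow hd ρ) hnn hlim
  have h2 := integrableOn_Ioi_deriv_of_nonneg' (fun ρ _ => hasDerivAt_sine_pow hd ρ) hnn hlim
  simp only [one_pow, zero_div, zero_pow hd, sub_zero] at h1
  rw [← h1]
  exact setIntegral_mono_on h2 hint measurableSet_Ioi fun ρ hρ => sine_weight_le (le_of_lt hρ)

/-- Since ρ ≤ √(1 + ρ²), for d ≥ 2 the radial density is at most ρ(1 + ρ²)^(−3/2), whose total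
integral is 1. -/
lemma integral_cauchyWeight_le_one {d : ℕ} (hd : 2 ≤ d)
    (hint : IntegrableOn (fun ρ => ρ ^ (d - 1) * cauchyWeight d ρ) (Set.Ioi 0)) :
    ∫ ρ in Set.Ioi (0 : ℝ), ρ ^ (d - 1) * cauchyWeight d ρ ≤ 1 := by
  have hder : ∀ ρ : ℝ, HasDerivAt (fun ρ : ℝ => -(√(1 + ρ ^ 2))⁻¹)
      (ρ * (√(1 + ρ ^ 2) ^ 3)⁻¹) ρ := by
    intro ρ
    have hpos : (0 : ℝ) < 1 + ρ ^ 2 := by positivity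
    have := (((((hasDerivAt_id ρ).pow 2).const_add 1).sqrt hpos.ne').inv (by positivity)).neg
    refine this.congr_deriv ?_
    have hs : √(1 + ρ ^ 2) ≠ 0 := by positivity
    simp only [id, Nat.cast_ofNat, Pi.pow_apply]
    field_simp
    norm_num
  have hlim : Tendsto (fun ρ : ℝ => -(√(1 + ρ ^ 2))⁻¹) atTop (nhds (-0)) := by
    refine Tendsto.neg (tendsto_inv_atTop_zero.comp (Real.tendsto_sqrt_atTop.comp ?_))
    exact tendsto_atTop_add_const_left _ _ (tendsto_pow_atTop (by norm_num))
  have hnn : ∀ ρ ∈ Set.Ioi (0 : ℝ), 0 ≤ ρ * (√(1 + ρ ^ 2) ^ 3)⁻¹ := by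
    intro ρ hρ
    have : (0 : ℝ) < ρ := hρ
    positivity
  have h1 := integral_Ioi_of_hasDerivAt_of_nonneg' (fun ρ _ => hder ρ) hnn hlim
  have h2 := integrableOn_Ioi_deriv_of_nonneg' (fun ρ _ => hder ρ) hnn hlim
  have h3 : -0 - -(√(1 + (0 : ℝ) ^ 2))⁻¹ = 1 := by norm_num
  rw [← h3, ← h1]
  refine setIntegral_mono_on hint h2 measurableSet_Ioi fun ρ hρ => ?_
  have hρ0 : (0 : ℝ) < ρ := hρ
  obtain ⟨m, rfl⟩ := Nat.exists_eq_add_of_le hd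
  have hle : ρ ≤ √(1 + ρ ^ 2) := Real.le_sqrt_of_sq_le (by linarith)
  have hs : 0 < √(1 + ρ ^ 2) := by positivity
  rw [cauchyWeight, show 2 + m - 1 = m + 1 by omega, show 2 + m + 1 = m + 3 by omega,
    ← div_eq_mul_inv, ← div_eq_mul_inv, div_le_div_iff₀ (by positivity) (by positivity)]
  calc ρ ^ (m + 1) * √(1 + ρ ^ 2) ^ 3 = ρ * √(1 + ρ ^ 2) ^ 3 * ρ ^ m := by ring
    _ ≤ ρ * √(1 + ρ ^ 2) ^ 3 * √(1 + ρ ^ 2) ^ m := by gcongr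
    _ = _ := by ring

variable {F : Type*} [NormedAddCommGroup F] [InnerProductSpace ℝ F] [FiniteDimensional ℝ F]
  [MeasurableSpace F] [BorelSpace F]

/-- The radial integral over the half-line is at least 1/d, so normalization gives K ≤ d; on (0, r]
the Cauchy weight is at most 1. -/
lemma coneProb_le_pow [Nontrivial F] {r : ℝ} (hr : 0 ≤ r) :
    coneProb F r ≤ r ^ Module.finrank ℝ F := by
  obtain ⟨K, hK, h1, h2⟩ := exists_coneProb_eq F
  have hd : Module.finrank ℝ F ≠ 0 := Module.finrank_pos.ne'
  set d := Module.finrank ℝ F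
  have hint : IntegrableOn (fun ρ => ρ ^ (d - 1) * cauchyWeight d ρ) (Set.Ioi 0) := by
    -- Without integrability the integral would be 0 by convention, and the normalization would read
    -- 0 = 1.
    by_contra h
    rw [integral_undef h] at h1
    simp at h1
  have hd0 : (0 : ℝ) < d := by positivity
  have hKd : K ≤ d := by
    have := mul_le_mul_of_nonneg_left (one_div_le_integral_cauchyWeight hd hint) hK
    rw [h1, mul_one_div, div_le_one hd0] at this
    exact this
  have hI : ∫ ρ in Set.Ioc 0 r, ρ ^ (d - 1) * cauchyWeight d ρ ≤ r ^ d / d := by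
    calc ∫ ρ in Set.Ioc 0 r, ρ ^ (d - 1) * cauchyWeight d ρ
        ≤ ∫ ρ in Set.Ioc 0 r, ρ ^ (d - 1) := by
          refine setIntegral_mono_on (hint.mono_set Set.Ioc_subset_Ioi_self)
            ((continuous_pow _).integrableOn_Ioc) measurableSet_Ioc fun ρ hρ => ?_
          refine mul_le_of_le_one_right (pow_nonneg hρ.1.le _) ?_
          exact inv_le_one_of_one_le₀ (one_le_pow₀ (one_le_sqrt_one_add_sq ρ))
      _ = r ^ d / d := by
          rw [← intervalIntegral.integral_of_le hr, integral_pow]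
          have : d - 1 + 1 = d := Nat.succ_pred_eq_of_ne_zero hd
          have h' : ((d - 1 : ℕ) : ℝ) + 1 = d := by exact_mod_cast this
          rw [this, h', zero_pow hd, sub_zero]
  rw [h2 r hr]
  calc K * _ ≤ K * (r ^ d / d) := by gcongr
    _ ≤ d * (r ^ d / d) := by gcongr
    _ = r ^ d := by field_simp

/-- Here normalization gives K ≥ 1, and the minorant of the radial density integrates exactly to the
power of the sine. -/
lemma le_coneProb (hF : 2 ≤ Module.finrank ℝ F) {r : ℝ} (hr : 0 ≤ r) :
    (r / √(1 + r ^ 2)) ^ Module.finrank ℝ F / Module.finrank ℝ F ≤ coneProb F r := by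
  have : Nontrivial F := Module.nontrivial_of_finrank_pos (R := ℝ) (by omega)
  obtain ⟨K, hK, h1, h2⟩ := exists_coneProb_eq F
  set d := Module.finrank ℝ F
  have hd : d ≠ 0 := by omega
  have hint : IntegrableOn (fun ρ => ρ ^ (d - 1) * cauchyWeight d ρ) (Set.Ioi 0) := by
    by_contra h
    rw [integral_undef h] at h1
    simp at h1
  have hK1 : 1 ≤ K := by
    have := mul_le_mul_of_nonneg_left (integral_cauchyWeight_le_one hF hint) hK
    rwa [h1, mul_one] at this
  have hcont : Continuous (fun ρ : ℝ => ρ ^ (d - 1) * (√(1 + ρ ^ 2) ^ (d + 2))⁻¹) :=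
    (continuous_pow _).mul (Continuous.inv₀ (by fun_prop) fun ρ => by positivity)
  have hI : (r / √(1 + r ^ 2)) ^ d / d ≤ ∫ ρ in Set.Ioc 0 r, ρ ^ (d - 1) * cauchyWeight d ρ := by
    have h3 := intervalIntegral.integral_eq_sub_of_hasDerivAt (a := 0) (b := r)
      (fun ρ _ => hasDerivAt_sine_pow hd ρ) (hcont.intervalIntegrable _ _)
    simp only [zero_div, zero_pow hd, sub_zero] at h3
    rw [← h3, intervalIntegral.integral_of_le hr]
    exact setIntegral_mono_on hcont.integrableOn_Ioc (hint.mono_set Set.Ioc_subset_Ioi_self)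
      measurableSet_Ioc fun ρ hρ => sine_weight_le hρ.1.le
  rw [h2 r hr]
  refine hI.trans (le_mul_of_one_le_left (le_trans (by positivity) hI) hK1)

end ConeBounds

instance isProbabilityMeasure_chiSquared (d : ℕ) : IsProbabilityMeasure (chiSquared d) :=
  Measure.isProbabilityMeasure_map (by fun_prop)

/-! ### Angles between a fixed vector and a Gaussian vector. -/

section Angle

variable {E : Type*} [NormedAddCommGroup E] [InnerProductSpace ℝ E] [FiniteDimensional ℝ E]
  [MeasurableSpace E] [BorelSpace E]

/-- The cone probability depends on the space only through its dimension, which lets it be moved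
from a subspace to a coordinate space. -/
lemma coneProb_eq_chiSquared {r : ℝ} (hr : 0 ≤ r) :
    coneProb E r = ((chiSquared 1).prod (chiSquared (Module.finrank ℝ E))).real
      {p | p.2 ≤ r ^ 2 * p.1} := by
  have h1 : chiSquared 1 = (stdGaussian ℝ).map fun x => ‖x‖ ^ 2 := by
    rw [stdGaussian_map_norm_sq, Module.finrank_self]
  rw [h1, ← stdGaussian_map_norm_sq, Measure.map_prod_map _ _ (by fun_prop) (by fun_prop),
    map_measureReal_apply (by fun_prop) (measurableSet_le (by fun_prop) (by fun_prop)), coneProb]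
  congr 1
  ext p
  simp only [Set.mem_ofPred_eq, Set.mem_preimage, Prod.map_fst, Prod.map_snd, Real.norm_eq_abs]
  rw [← mul_pow, sq_le_sq₀ (by positivity) (by positivity)]

omit [MeasurableSpace E] [BorelSpace E] in
lemma starProjection_orthogonal_inf {K S : Submodule ℝ E} (h : K ≤ S) (u : E) :
    (Kᗮ ⊓ S).starProjection u = S.starProjection u - K.starProjection u := by
  refine Submodule.eq_starProjection_of_mem_of_inner_eq_zero (K := Kᗮ ⊓ S) ?_ ?_
  · refine ⟨(Submodule.mem_orthogonal _ _).mpr ?_,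
      S.sub_mem (S.starProjection_apply_mem u) (h (K.starProjection_apply_mem u))⟩
    intro v hv
    have h1 : inner ℝ v (u - K.starProjection u) = 0 :=
      Submodule.inner_right_of_mem_orthogonal hv (K.sub_starProjection_mem_orthogonal u)
    have h2 : inner ℝ v (u - S.starProjection u) = 0 :=
      Submodule.inner_right_of_mem_orthogonal (h hv) (S.sub_starProjection_mem_orthogonal u)
    rw [inner_sub_right] at h1 h2 ⊢
    linarith
  · intro w hw
    have h1 : inner ℝ (u - S.starProjection u) w = 0 :=
      Submodule.inner_left_of_mem_orthogonal hw.2 (S.sub_starProjection_mem_orthogonal u)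
    have h2 : inner ℝ (K.starProjection u) w = 0 :=
      Submodule.inner_right_of_mem_orthogonal (K.starProjection_apply_mem u) hw.1
    rw [sub_sub_eq_add_sub, inner_sub_left, inner_add_left, h2]
    rw [inner_sub_left] at h1
    linarith

omit [MeasurableSpace E] [BorelSpace E] in
lemma norm_sq_starProjection_add {K S : Submodule ℝ E} (h : K ≤ S) (u : E) :
    ‖S.starProjection u‖ ^ 2 =
      ‖K.starProjection u‖ ^ 2 + ‖(Kᗮ ⊓ S).starProjection u‖ ^ 2 := by
  have h1 : S.starProjection u = K.starProjection u + (Kᗮ ⊓ S).starProjection u := by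
    rw [starProjection_orthogonal_inf h]; abel
  have h2 : inner ℝ (K.starProjection u) ((Kᗮ ⊓ S).starProjection u) = 0 :=
    Submodule.inner_right_of_mem_orthogonal (K.starProjection_apply_mem u)
      ((Kᗮ ⊓ S).starProjection_apply_mem u).1
  rw [h1, norm_add_sq_real, h2]; ring

omit [FiniteDimensional ℝ E] [MeasurableSpace E] [BorelSpace E] in
lemma inner_sq_eq_norm_sq_mul (w u : E) :
    inner ℝ w u ^ 2 = ‖w‖ ^ 2 * ‖(ℝ ∙ w).starProjection u‖ ^ 2 := by
  rcases eq_or_ne w 0 with rfl | hw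
  · simp
  have : ‖w‖ ≠ 0 := norm_ne_zero_iff.mpr hw
  rw [Submodule.starProjection_singleton, norm_smul, mul_pow, Real.norm_eq_abs, sq_abs]
  simp only [RCLike.ofReal_real_eq_id, id]
  field_simp

lemma sq_add_ineq_iff {s A B : ℝ} (hs1 : s < 1) (hs0 : 0 ≤ s) :
    (1 - s ^ 2) * (A + B) ≤ A ↔ B ≤ (s / √(1 - s ^ 2)) ^ 2 * A := by
  have h : 0 < 1 - s ^ 2 := by nlinarith
  rw [div_pow, Real.sq_sqrt h.le, div_mul_eq_mul_div, le_div_iff₀ h]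
  constructor <;> intro h' <;> linarith

/-- The law of the angle between a fixed vector `w` of a subspace `S` and the projection on `S` of a
standard Gaussian vector. -/
lemma measureReal_angle_eq {S : Submodule ℝ E} {w : E} (hw : w ∈ S) (hw0 : w ≠ 0) {s : ℝ}
    (hs0 : 0 ≤ s) (hs1 : s < 1) :
    (stdGaussian E).real {u | (1 - s ^ 2) * (‖w‖ ^ 2 * ‖S.starProjection u‖ ^ 2) ≤
        inner ℝ w u ^ 2} =
      coneProb (EuclideanSpace ℝ (Fin (Module.finrank ℝ S - 1))) (s / √(1 - s ^ 2)) := by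
  have hK : (ℝ ∙ w) ≤ S := (Submodule.span_singleton_le_iff_mem _ _).mpr hw
  have hrank := Submodule.finrank_add_inf_finrank_orthogonal hK
  have hK1 : Module.finrank ℝ (ℝ ∙ w) = 1 := finrank_span_singleton hw0
  -- Splitting S into the line of w and its complement in S gives independent chi-squared variables
  -- with 1 and dim S − 1 degrees of freedom; the angle condition compares the two.
  have hort : (ℝ ∙ w) ⟂ ((ℝ ∙ w)ᗮ ⊓ S) :=
    (Submodule.isOrtho_orthogonal_right _).mono_right inf_le_left
  have hmap := stdGaussian_map_norm_sq_prod hort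
  have hr : 0 ≤ s / √(1 - s ^ 2) := by positivity
  rw [coneProb_eq_chiSquared hr, finrank_euclideanSpace_fin]
  rw [hK1, show Module.finrank ℝ ((ℝ ∙ w)ᗮ ⊓ S : Submodule ℝ E) = Module.finrank ℝ S - 1 by omega]
    at hmap
  rw [← hmap, map_measureReal_apply (by fun_prop) (measurableSet_le (by fun_prop) (by fun_prop))]
  congr 1
  ext u
  have hwpos : 0 < ‖w‖ ^ 2 := by positivity
  simp only [Set.mem_ofPred_eq, Set.mem_preimage]
  rw [inner_sq_eq_norm_sq_mul, mul_left_comm, mul_le_mul_iff_right₀ hwpos,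
    norm_sq_starProjection_add hK, sq_add_ineq_iff hs1 hs0]

lemma measureReal_angle_le {S : Submodule ℝ E} {w : E} (hw : w ∈ S) (hw0 : w ≠ 0) {s : ℝ}
    (hs0 : 0 ≤ s) (hs1 : s < 1) (hS : 2 ≤ Module.finrank ℝ S) :
    (stdGaussian E).real {u | (1 - s ^ 2) * (‖w‖ ^ 2 * ‖S.starProjection u‖ ^ 2) ≤
        inner ℝ w u ^ 2} ≤ (s / √(1 - s ^ 2)) ^ (Module.finrank ℝ S - 1) := by
  rw [measureReal_angle_eq hw hw0 hs0 hs1]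
  have : Nonempty (Fin (Module.finrank ℝ S - 1)) := ⟨⟨0, by omega⟩⟩
  have := coneProb_le_pow (F := EuclideanSpace ℝ (Fin (Module.finrank ℝ S - 1)))
    (r := s / √(1 - s ^ 2)) (by positivity)
  rwa [finrank_euclideanSpace_fin] at this

lemma le_coneProb_sine {d : ℕ} (hd : 2 ≤ d) {s : ℝ} (hs0 : 0 ≤ s) (hs1 : s < 1) :
    s ^ d / d ≤ coneProb (EuclideanSpace ℝ (Fin d)) (s / √(1 - s ^ 2)) := by
  have := le_coneProb (F := EuclideanSpace ℝ (Fin d)) (by rwa [finrank_euclideanSpace_fin])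
    (r := s / √(1 - s ^ 2)) (by positivity)
  rw [finrank_euclideanSpace_fin] at this
  have h : 0 < 1 - s ^ 2 := by nlinarith
  have h2 : 1 + (s / √(1 - s ^ 2)) ^ 2 = (1 - s ^ 2)⁻¹ := by
    rw [div_pow, Real.sq_sqrt h.le]; field_simp; ring
  rw [h2, Real.sqrt_inv, div_inv_eq_mul, div_mul_cancel₀ _ (by positivity)] at this
  exact this

end Angle

/-! ### Finding a close sample outside a bad set. -/

section Covering

open scoped ENNReal

/-- Convexity of the power on [1 − q, 1]. The error b/q is free of L, which is what removes the
factor L that a union bound over samples would cost. -/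
lemma pow_one_sub_add_le {q b : ℝ} (hq : 0 < q) (hq1 : q ≤ 1) (hb : 0 ≤ b) (hbq : b ≤ q) (L : ℕ) :
    (1 - q + b) ^ L ≤ (1 - q) ^ L + b / q := by
  have h := (convexOn_pow (𝕜 := ℝ) L).2 (show 1 - q ∈ Set.Ici (0 : ℝ) by simpa using hq1)
    (show (1 : ℝ) ∈ Set.Ici (0 : ℝ) by simp)
    (show 0 ≤ 1 - b / q by rw [sub_nonneg, div_le_one hq]; exact hbq)
    (show 0 ≤ b / q by positivity) (by ring)
  simp only [smul_eq_mul, mul_one, one_pow] at h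
  have h1 : (1 - b / q) * (1 - q) + b / q = 1 - q + b := by field_simp; ring
  rw [h1] at h
  have h2 : 0 ≤ b / q * (1 - q) ^ L := by
    have : 0 ≤ 1 - q := by linarith
    positivity
  linarith

/-- If independent points `u₁, …, u_L` are each close to an independent point `v` with probability
`q`, then the probability that no close point avoids a bad set is at most the probability
`(1 - q) ^ L` that no point is close, plus the probability of the bad set. -/
lemma measureReal_no_good_close_le {E : Type*} [MeasurableSpace E] (ν : Measure E)
    [IsProbabilityMeasure ν] {close : Set (E × E)} {bad : Set E} (hclose : MeasurableSet close)
    (hbad : MeasurableSet bad) {q : ℝ} (hq : 0 < q)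
    (h1 : ∀ᵐ v ∂ν, ν.real {u | (u, v) ∈ close} = q)
    (h2 : ∀ᵐ u ∂ν, ν.real {v | (u, v) ∈ close} = q) (L : ℕ) :
    ((Measure.pi fun _ : Fin L => ν).prod ν).real
      {p | ∀ ℓ, ¬ ((p.1 ℓ, p.2) ∈ close ∧ p.1 ℓ ∉ bad)} ≤ (1 - q) ^ L + ν.real bad := by
  have hq1 : q ≤ 1 := by
    obtain ⟨v, hv⟩ := h1.exists
    exact hv ▸ measureReal_le_one
  have hms : MeasurableSet {p : (Fin L → E) × E | ∀ ℓ, ¬ ((p.1 ℓ, p.2) ∈ close ∧ p.1 ℓ ∉ bad)} := by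
    rw [Set.ofPred_forall]
    refine MeasurableSet.iInter fun ℓ => MeasurableSet.compl (MeasurableSet.inter ?_ ?_)
    · exact hclose.preimage (f := fun p : (Fin L → E) × E => (p.1 ℓ, p.2)) (by fun_prop)
    · exact hbad.compl.preimage (f := fun p : (Fin L → E) × E => p.1 ℓ) (by fun_prop)
  have hsec : ∀ v, MeasurableSet {u | (u, v) ∈ close} := fun v =>
    hclose.preimage (f := fun u => (u, v)) (by fun_prop)
  -- Integrating over v first: each bad u is close to v with the same probability q. This q cancels
  -- the 1/q of the convexity bound.
  have hsum : ∫⁻ v, ν ({u | (u, v) ∈ close} ∩ bad) ∂ν = ENNReal.ofReal q * ν bad := by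
    have hm : MeasurableSet (close ∩ Prod.fst ⁻¹' bad) :=
      hclose.inter (hbad.preimage measurable_fst)
    have e1 := Measure.prod_apply_symm (μ := ν) (ν := ν) hm
    have e2 := Measure.prod_apply (μ := ν) (ν := ν) hm
    have e3 : ∀ᵐ u ∂ν, ν (Prod.mk u ⁻¹' (close ∩ Prod.fst ⁻¹' bad)) =
        bad.indicator (fun _ => ENNReal.ofReal q) u := by
      filter_upwards [h2] with u hu
      by_cases hub : u ∈ bad
      · rw [Set.indicator_of_mem hub, ← hu, ofReal_measureReal]
        congr 1
        ext v
        simp [hub]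
      · rw [Set.indicator_of_notMem hub]
        convert measure_empty (μ := ν)
        ext v
        simp [hub]
    rw [lintegral_congr_ae e3, lintegral_indicator_const hbad] at e2
    rw [← e2, e1]
    rfl
  have hpt : ∀ᵐ v ∂ν, (Measure.pi fun _ : Fin L => ν)
      ((fun us => (us, v)) ⁻¹' {p | ∀ ℓ, ¬ ((p.1 ℓ, p.2) ∈ close ∧ p.1 ℓ ∉ bad)}) ≤
      ENNReal.ofReal ((1 - q) ^ L) + (ENNReal.ofReal q)⁻¹ * ν ({u | (u, v) ∈ close} ∩ bad) := by
    filter_upwards [h1] with v hv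
    have hset : (fun us : Fin L → E => (us, v)) ⁻¹'
        {p | ∀ ℓ, ¬ ((p.1 ℓ, p.2) ∈ close ∧ p.1 ℓ ∉ bad)} =
        Set.univ.pi fun _ => ({u | (u, v) ∈ close} \ bad)ᶜ := by
      ext us
      simp [Set.mem_pi]
    have hreal : ν.real (({u | (u, v) ∈ close} \ bad)ᶜ) =
        1 - q + ν.real ({u | (u, v) ∈ close} ∩ bad) := by
      rw [probReal_compl_eq_one_sub ((hsec v).diff hbad), ← hv,
        ← measureReal_inter_add_sdiff (s := {u | (u, v) ∈ close}) hbad]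
      ring
    rw [hset, Measure.pi_pi, Finset.prod_const, Finset.card_univ, Fintype.card_fin,
      ← ofReal_measureReal, ← ofReal_measureReal (s := {u | (u, v) ∈ close} ∩ bad), hreal,
      ← ENNReal.ofReal_inv_of_pos hq, ← ENNReal.ofReal_mul (by positivity),
      ← ENNReal.ofReal_pow (by have := measureReal_nonneg (μ := ν) (s := {u | (u, v) ∈ close} ∩ bad)
                               linarith),
      ← ENNReal.ofReal_add (pow_nonneg (by linarith) _) (by positivity)]
    refine ENNReal.ofReal_le_ofReal ?_
    rw [inv_mul_eq_div]
    exact pow_one_sub_add_le hq hq1 measureReal_nonneg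
      (hv ▸ measureReal_mono Set.inter_subset_left) L
  have hfin : ((Measure.pi fun _ : Fin L => ν).prod ν)
      {p | ∀ ℓ, ¬ ((p.1 ℓ, p.2) ∈ close ∧ p.1 ℓ ∉ bad)} ≤
      ENNReal.ofReal ((1 - q) ^ L + ν.real bad) := by
    rw [Measure.prod_apply_symm hms]
    refine (lintegral_mono_ae hpt).trans ?_
    rw [lintegral_add_left measurable_const, lintegral_const, measure_univ, mul_one,
      lintegral_const_mul' _ _ (by simpa using hq), hsum, ← mul_assoc,
      ENNReal.inv_mul_cancel (by simpa using hq) ENNReal.ofReal_ne_top, one_mul,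
      ENNReal.ofReal_add (pow_nonneg (by linarith) _) measureReal_nonneg, ofReal_measureReal]
  exact ENNReal.toReal_le_of_le_ofReal
    (add_nonneg (pow_nonneg (by linarith) _) measureReal_nonneg) hfin

end Covering

/-! ### Residuals of orthogonal projections. -/

section Residuals

variable {E : Type*} [NormedAddCommGroup E] [InnerProductSpace ℝ E] [FiniteDimensional ℝ E]

lemma norm_sub_starProjection_le (S : Submodule ℝ E) (x : E) :
    ‖x - S.starProjection x‖ ≤ ‖x‖ := by
  have := Sᗮ.norm_starProjection_apply_le x
  rwa [Submodule.starProjection_orthogonal, _root_.sub_apply,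
    ContinuousLinearMap.id_apply] at this

lemma norm_sub_starProjection_le_of_mem {S : Submodule ℝ E} {w : E} (hw : w ∈ S) (x : E) :
    ‖x - S.starProjection x‖ ≤ ‖x - w‖ := by
  have := norm_sub_starProjection_le S (x - w)
  rwa [map_sub, S.starProjection_eq_self_iff.mpr hw, sub_sub_sub_cancel_right] at this

lemma norm_sq_sub_starProjection (S : Submodule ℝ E) (x : E) :
    ‖x - S.starProjection x‖ ^ 2 = ‖x‖ ^ 2 - ‖S.starProjection x‖ ^ 2 := by
  have := S.norm_sq_eq_add_norm_sq_starProjection x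
  rw [Submodule.starProjection_orthogonal, _root_.sub_apply,
    ContinuousLinearMap.id_apply] at this
  linarith

lemma norm_sub_starProjection_add_le (S : Submodule ℝ E) (x y : E) :
    ‖x + y - S.starProjection (x + y)‖ ≤
      ‖x - S.starProjection x‖ + ‖y - S.starProjection y‖ := by
  rw [map_add, add_sub_add_comm]
  exact norm_add_le _ _

-- The distance from w to the line of g is ‖w‖ times the sine of their angle, and the hypothesis
-- says that this sine is at least ε.
omit [FiniteDimensional ℝ E] in
lemma mul_norm_le_norm_sub_smul {w g : E} {ε : ℝ} (hε0 : 0 ≤ ε) (hε1 : ε ≤ 1)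
    (h : inner ℝ w g ^ 2 ≤ (1 - ε ^ 2) * (‖w‖ ^ 2 * ‖g‖ ^ 2)) (t : ℝ) :
    ε * ‖w‖ ≤ ‖w - t • g‖ := by
  have hε : 0 ≤ 1 - ε ^ 2 := by nlinarith
  have h1 : (2 * t * inner ℝ w g) ^ 2 ≤ ((1 - ε ^ 2) * ‖w‖ ^ 2 + t ^ 2 * ‖g‖ ^ 2) ^ 2 := by
    calc (2 * t * inner ℝ w g) ^ 2 = 4 * t ^ 2 * inner ℝ w g ^ 2 := by ring
      _ ≤ 4 * t ^ 2 * ((1 - ε ^ 2) * (‖w‖ ^ 2 * ‖g‖ ^ 2)) := by gcongr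
      _ ≤ _ := by nlinarith [sq_nonneg ((1 - ε ^ 2) * ‖w‖ ^ 2 - t ^ 2 * ‖g‖ ^ 2)]
  have h2 := abs_le_of_sq_le_sq' h1 (by positivity)
  refine le_of_sq_le_sq ?_ (norm_nonneg _)
  rw [norm_sub_sq_real, inner_smul_right, norm_smul, mul_pow, mul_pow, Real.norm_eq_abs, sq_abs]
  linarith [h2.2]

end Residuals

/-! ### Recovery of the true permutation. -/

section Design

variable {n p₁ p₂ : ℕ} (X : Matrix (Fin n) (Fin p₁) ℝ) (Z : Matrix (Fin n) (Fin p₂) ℝ)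

lemma mulVec_mem_colSpace {ι : Type*} [Fintype ι] [DecidableEq ι] (A : Matrix (Fin n) ι ℝ)
    (v : ι → ℝ) : WithLp.toLp 2 (A *ᵥ v) ∈ colSpace A :=
  ⟨WithLp.toLp 2 v, rfl⟩

lemma mem_colSpace_iff {ι : Type*} [Fintype ι] [DecidableEq ι] {A : Matrix (Fin n) ι ℝ}
    {y : EuclideanSpace ℝ (Fin n)} : y ∈ colSpace A ↔ ∃ v : ι → ℝ, WithLp.toLp 2 (A *ᵥ v) = y :=
  ⟨fun ⟨v, hv⟩ => ⟨v, hv⟩, fun ⟨v, hv⟩ => ⟨WithLp.toLp 2 v, hv⟩⟩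

lemma finrank_colSpace {ι : Type*} [Fintype ι] [DecidableEq ι] (A : Matrix (Fin n) ι ℝ) :
    Module.finrank ℝ (colSpace A) = A.rank := by
  rw [Matrix.rank_eq_finrank_range_toLin A (PiLp.basisFun 2 ℝ (Fin n)) (PiLp.basisFun 2 ℝ ι)]
  rfl

lemma mem_colSpace_augDesign_iff {π : Equiv.Perm (Fin n)} {u y : EuclideanSpace ℝ (Fin n)} :
    y ∈ colSpace (augDesign X Z π u) ↔ ∃ w ∈ colSpace (design X Z π), ∃ t : ℝ, y = w + t • u := by
  have key : ∀ (v : Fin p₁ ⊕ Fin p₂ → ℝ) (t : Unit → ℝ),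
      WithLp.toLp 2 (augDesign X Z π u *ᵥ Sum.elim v t) =
        WithLp.toLp 2 (design X Z π *ᵥ v) + t () • u := by
    intro v t
    rw [augDesign, Matrix.fromCols_mulVec_sumElim, WithLp.toLp_add]
    congr 1
    ext i
    simp [Matrix.mulVec, dotProduct, mul_comm]
  simp only [mem_colSpace_iff]
  constructor
  · rintro ⟨v, rfl⟩
    refine ⟨_, ⟨v ∘ Sum.inl, rfl⟩, v (Sum.inr ()), ?_⟩
    rw [show v (Sum.inr ()) = (v ∘ Sum.inr) () from rfl, ← key (v ∘ Sum.inl) (v ∘ Sum.inr),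
      Sum.elim_comp_inl_inr]
  · rintro ⟨_, ⟨v, rfl⟩, t, rfl⟩
    exact ⟨Sum.elim v fun _ => t, key v fun _ => t⟩

lemma signal_mem_colSpace (π : Equiv.Perm (Fin n)) (β : (Fin p₁ → ℝ) × (Fin p₂ → ℝ)) :
    signal X Z π β ∈ colSpace (design X Z π) :=
  mulVec_mem_colSpace _ _

/-- The component of the true signal orthogonal to the range of `W(Π)`. -/
noncomputable def signalGap (π₀ : Equiv.Perm (Fin n)) (β : (Fin p₁ → ℝ) × (Fin p₂ → ℝ))
    (π : Equiv.Perm (Fin n)) : EuclideanSpace ℝ (Fin n) :=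
  signal X Z π₀ β - projM (design X Z π) (signal X Z π₀ β)

lemma signalGap_eq (π₀ : Equiv.Perm (Fin n)) (β : (Fin p₁ → ℝ) × (Fin p₂ → ℝ))
    (π : Equiv.Perm (Fin n)) :
    signalGap X Z π₀ β π = (colSpace (design X Z π))ᗮ.starProjection (signal X Z π₀ β) := by
  rw [Submodule.starProjection_orthogonal]; rfl

/-- The event that the repro sample `u` and the noise `v` span a line at an angle with sine at
most `γ`. -/
def closePairs (n : ℕ) (γ : ℝ) :
    Set (EuclideanSpace ℝ (Fin n) × EuclideanSpace ℝ (Fin n)) :=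
  {p | (1 - γ ^ 2) * (‖p.1‖ ^ 2 * ‖p.2‖ ^ 2) ≤ inner ℝ p.1 p.2 ^ 2}

/-- The repro samples that vanish, or that for some wrong permutation `Π` are nearly aligned with
the signal once the range of `W(Π)` is projected out. -/
def alignedSamples (k : ℕ) (π₀ : Equiv.Perm (Fin n)) (β : (Fin p₁ → ℝ) × (Fin p₂ → ℝ)) (ε : ℝ) :
    Set (EuclideanSpace ℝ (Fin n)) :=
  {0} ∪ ⋃ π ∈ (sparsePerms n k).erase π₀, {u | (1 - ε ^ 2) * (‖signalGap X Z π₀ β π‖ ^ 2 *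
    ‖(colSpace (design X Z π))ᗮ.starProjection u‖ ^ 2) ≤ inner ℝ (signalGap X Z π₀ β π) u ^ 2}

/-- The zero sample is formally close to every v but explains nothing. This is why `alignedSamples`
contains 0, at no cost in probability. -/
lemma norm_residual_le_of_close {γ : ℝ} (hγ : 0 ≤ γ) {u v : EuclideanSpace ℝ (Fin n)} (hu : u ≠ 0)
    (h : (u, v) ∈ closePairs n γ) : ‖v - (ℝ ∙ u).starProjection v‖ ≤ γ * ‖v‖ := by
  have h1 : (1 - γ ^ 2) * (‖u‖ ^ 2 * ‖v‖ ^ 2) ≤ inner ℝ u v ^ 2 := h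
  have hu2 : 0 < ‖u‖ ^ 2 := by positivity
  rw [inner_sq_eq_norm_sq_mul, mul_left_comm, mul_le_mul_iff_right₀ hu2] at h1
  refine le_of_sq_le_sq ?_ (by positivity)
  rw [norm_sq_sub_starProjection, mul_pow]
  linarith

lemma eq_of_mem_reproArgmin {k : ℕ} {π₀ π : Equiv.Perm (Fin n)}
    {β : (Fin p₁ → ℝ) × (Fin p₂ → ℝ)} {σ γ ε : ℝ} (hσ : 0 ≤ σ) (hγ : 0 ≤ γ) (hε0 : 0 ≤ ε)
    (hε1 : ε ≤ 1) (hπ₀ : π₀ ∈ sparsePerms n k) {u v : EuclideanSpace ℝ (Fin n)}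
    (hclose : (u, v) ∈ closePairs n γ) (hgood : u ∉ alignedSamples X Z k π₀ β ε)
    (hsep : ∀ π ∈ sparsePerms n k, π ≠ π₀ → 2 * (σ * (γ * ‖v‖)) < ε * ‖signalGap X Z π₀ β π‖)
    (hπ : π ∈ reproArgmin X Z k (signal X Z π₀ β + σ • v) u) : π = π₀ := by
  by_contra hne
  simp only [alignedSamples, Set.mem_union, Set.mem_singleton_iff, Set.mem_iUnion, not_or,
    not_exists, Set.mem_ofPred_eq, not_le, Finset.mem_erase] at hgood
  obtain ⟨hu, hgood⟩ := hgood
  have hal := hgood π ⟨hne, hπ.1⟩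
  have hs := hsep π hπ.1 hne
  have hmin := hπ.2 π₀ hπ₀
  have hres := norm_residual_le_of_close hγ hu hclose
  have hmem : ∀ π', (ℝ ∙ u).starProjection v ∈ colSpace (augDesign X Z π' u) := by
    intro π'
    rw [mem_colSpace_augDesign_iff, Submodule.starProjection_singleton]
    exact ⟨0, Submodule.zero_mem _, _, (zero_add _).symm⟩
  have hnoise : ∀ π', ‖v - projM (augDesign X Z π' u) v‖ ≤ γ * ‖v‖ := fun π' =>
    (norm_sub_starProjection_le_of_mem (hmem π') v).trans hres
  have hscale : ∀ π', ‖σ • v - projM (augDesign X Z π' u) (σ • v)‖ ≤ σ * (γ * ‖v‖) := by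
    intro π'
    rw [map_smul, ← smul_sub, norm_smul, Real.norm_eq_abs, abs_of_nonneg hσ]
    exact mul_le_mul_of_nonneg_left (hnoise π') hσ
  have hup : ‖signal X Z π₀ β + σ • v - projM (augDesign X Z π₀ u) (signal X Z π₀ β + σ • v)‖ ≤
      σ * (γ * ‖v‖) := by
    have h0 : projM (augDesign X Z π₀ u) (signal X Z π₀ β) = signal X Z π₀ β := by
      refine Submodule.starProjection_eq_self_iff.mpr ?_
      rw [mem_colSpace_augDesign_iff]
      exact ⟨_, signal_mem_colSpace X Z π₀ β, 0, by simp⟩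
    rw [map_add, h0, add_sub_add_left_eq_sub]
    exact hscale π₀
  have hlow : ε * ‖signalGap X Z π₀ β π‖ ≤
      ‖signal X Z π₀ β - projM (augDesign X Z π u) (signal X Z π₀ β)‖ := by
    obtain ⟨w, hw, t, ht⟩ := (mem_colSpace_augDesign_iff X Z).mp
      ((colSpace (augDesign X Z π u)).starProjection_apply_mem (signal X Z π₀ β))
    set S := colSpace (design X Z π)
    have hin : inner ℝ (signalGap X Z π₀ β π) u =
        inner ℝ (signalGap X Z π₀ β π) (Sᗮ.starProjection u) := by
      rw [signalGap_eq, Submodule.inner_starProjection_left_eq_right,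
        Submodule.inner_starProjection_left_eq_right,
        Submodule.starProjection_eq_self_iff.mpr (Sᗮ.starProjection_apply_mem u)]
    rw [hin] at hal
    refine (mul_norm_le_norm_sub_smul hε0 hε1 hal.le t).trans ?_
    -- Projecting off the range S of W(Π) kills the component w and does not increase norms, so only
    -- the distance from the gap to the line of the projected u matters.
    have h1 : signalGap X Z π₀ β π - t • Sᗮ.starProjection u =
        Sᗮ.starProjection (signal X Z π₀ β - (w + t • u)) := by
      have hw0 : Sᗮ.starProjection w = 0 := by
        rw [Submodule.starProjection_orthogonal, _root_.sub_apply,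
          Submodule.starProjection_eq_self_iff.mpr hw]
        simp
      rw [signalGap_eq, map_sub, map_add, map_smul, hw0, zero_add]
    rw [h1, projM, ht]
    exact Submodule.norm_starProjection_apply_le _ _
  -- The signal is Y minus the noise: its residual under Π is at most that of Y, which minimality
  -- bounds by σγ‖v‖, plus another σγ‖v‖. This contradicts the separation.
  have htri := norm_sub_starProjection_add_le (colSpace (augDesign X Z π u))
    (signal X Z π₀ β + σ • v) (-(σ • v))
  rw [norm_sub_rev (-(σ • v)), map_neg, neg_sub_neg, add_neg_cancel_right] at htri
  have hsc := hscale π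
  rw [reproObjective, reproObjective, sq_le_sq₀ (norm_nonneg _) (norm_nonneg _)] at hmin
  rw [projM] at hlow hsc hmin
  linarith

end Design

/-! ### The F statistic at the true parameter. -/

section FStatistic

/-- Right continuity of the distribution function makes the infimum defining the quantile attained.
-/
lemma le_cdf_quantile (ν : Measure ℝ) {q : ℝ} (hq0 : 0 < q) (hq1 : q < 1) :
    q ≤ cdf ν (quantile ν q) := by
  have hne : {x : ℝ | q ≤ cdf ν x}.Nonempty :=
    (((tendsto_cdf_atTop ν).eventually_const_lt hq1).exists).imp fun x hx => hx.le
  have hbdd : BddBelow {x : ℝ | q ≤ cdf ν x} := by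
    obtain ⟨a, ha⟩ := ((tendsto_cdf_atBot ν).eventually_lt_const hq0).exists
    refine ⟨a, fun x hx => ?_⟩
    by_contra h
    exact absurd (hx.trans (monotone_cdf ν (not_le.mp h).le)) (not_le.mpr ha)
  have hright : Tendsto (cdf ν) (nhdsWithin (quantile ν q) (Set.Ioi (quantile ν q)))
      (nhds (cdf ν (quantile ν q))) :=
    ((cdf ν).right_continuous _).mono_left (nhdsWithin_mono _ Set.Ioi_subset_Ici_self)
  refine ge_of_tendsto hright ?_
  filter_upwards [self_mem_nhdsWithin] with y hy
  obtain ⟨s, hs, hsy⟩ := exists_lt_of_csInf_lt hne hy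
  exact le_trans hs (monotone_cdf ν hsy.le)

instance isProbabilityMeasure_fDist (a b : ℕ) : IsProbabilityMeasure (fDist a b) :=
  Measure.isProbabilityMeasure_map (by fun_prop)

variable {n p₁ p₂ : ℕ} (X : Matrix (Fin n) (Fin p₁) ℝ) (Z : Matrix (Fin n) (Fin p₂) ℝ)

lemma jointStat_eq {π : Equiv.Perm (Fin n)} {β : (Fin p₁ → ℝ) × (Fin p₂ → ℝ)} {σ : ℝ}
    (hσ : σ ≠ 0) (hn : p₁ + p₂ ≤ n) (v : EuclideanSpace ℝ (Fin n)) :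
    jointStat X Z (signal X Z π β + σ • v) π β =
      (‖(colSpace (design X Z π)).starProjection v‖ ^ 2 / (p₁ + p₂ : ℕ)) /
        (‖(colSpace (design X Z π))ᗮ.starProjection v‖ ^ 2 / (n - (p₁ + p₂) : ℕ)) := by
  set S := colSpace (design X Z π) with hS
  have h1 : inner ℝ (σ • v) (S.starProjection (σ • v)) = σ ^ 2 * ‖S.starProjection v‖ ^ 2 := by
    have := S.inner_starProjection_left_eq_right v (S.starProjection v)
    rw [Submodule.starProjection_eq_self_iff.mpr (S.starProjection_apply_mem v),
      real_inner_self_eq_norm_sq] at this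
    rw [map_smul, inner_smul_left, inner_smul_right, this]
    simp only [conj_trivial]; ring
  have h2 : inner ℝ (σ • v) (σ • v - S.starProjection (σ • v)) =
      σ ^ 2 * ‖Sᗮ.starProjection v‖ ^ 2 := by
    have := S.norm_sq_eq_add_norm_sq_starProjection v
    rw [inner_sub_right, h1, real_inner_self_eq_norm_sq, norm_smul, mul_pow, Real.norm_eq_abs,
      sq_abs, this]
    ring
  rw [jointStat]
  simp only [add_sub_cancel_left, projM, ← hS, h1, h2]
  rw [mul_div_mul_left _ _ (pow_ne_zero 2 hσ), div_div_div_eq, div_mul_div_comm]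
  rw [Nat.cast_sub hn]
  push_cast
  rw [mul_comm ((p₁ : ℝ) + p₂), mul_comm ((n : ℝ) - (p₁ + p₂))]

lemma measurable_jointStat (π : Equiv.Perm (Fin n)) (β : (Fin p₁ → ℝ) × (Fin p₂ → ℝ)) :
    Measurable fun y => jointStat X Z y π β := by
  unfold jointStat
  dsimp only
  fun_prop

lemma le_measureReal_jointStat_le {π : Equiv.Perm (Fin n)} {β : (Fin p₁ → ℝ) × (Fin p₂ → ℝ)}
    {σ α : ℝ} (hσ : σ ≠ 0) (hα : α ∈ Set.Ioo (0 : ℝ) 1) (hn : p₁ + p₂ ≤ n)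
    (hrank : (design X Z π).rank = p₁ + p₂) :
    α ≤ (stdGaussian (EuclideanSpace ℝ (Fin n))).real
      {v | jointStat X Z (signal X Z π β + σ • v) π β ≤
        quantile (fDist (p₁ + p₂) (n - (p₁ + p₂))) α} := by
  set S := colSpace (design X Z π) with hS
  have hS1 : Module.finrank ℝ S = p₁ + p₂ := by rw [hS, finrank_colSpace, hrank]
  have hS2 : Module.finrank ℝ Sᗮ = n - (p₁ + p₂) := by
    have := S.finrank_add_finrank_orthogonal
    rw [finrank_euclideanSpace_fin] at this
    omega
  have hlaw : (stdGaussian (EuclideanSpace ℝ (Fin n))).map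
      (fun v => jointStat X Z (signal X Z π β + σ • v) π β) =
      fDist (p₁ + p₂) (n - (p₁ + p₂)) := by
    have h := stdGaussian_map_norm_sq_prod S.isOrtho_orthogonal_right
    rw [hS1, hS2] at h
    rw [fDist, ← h, Measure.map_map (by fun_prop) (by fun_prop)]
    congr 1
    ext v
    rw [jointStat_eq X Z hσ hn]
    rfl
  have hm : Measurable fun v : EuclideanSpace ℝ (Fin n) =>
      jointStat X Z (signal X Z π β + σ • v) π β :=
    (measurable_jointStat X Z π β).comp (by fun_prop)
  refine (le_cdf_quantile (fDist (p₁ + p₂) (n - (p₁ + p₂))) hα.1 hα.2).trans_eq ?_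
  have h := map_measureReal_apply (μ := stdGaussian (EuclideanSpace ℝ (Fin n))) hm
    (measurableSet_Iic (a := quantile (fDist (p₁ + p₂) (n - (p₁ + p₂))) α))
  rw [hlaw] at h
  rw [cdf_eq_real, h]
  rfl

end FStatistic

/-! ### Probabilities of closeness and alignment. -/

section AlignedSamples

variable {n p₁ p₂ : ℕ} (X : Matrix (Fin n) (Fin p₁) ℝ) (Z : Matrix (Fin n) (Fin p₂) ℝ)

lemma measurableSet_closePairs (n : ℕ) (γ : ℝ) : MeasurableSet (closePairs n γ) :=
  measurableSet_le (by fun_prop) (by fun_prop)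

lemma measurableSet_alignedSamples (k : ℕ) (π₀ : Equiv.Perm (Fin n))
    (β : (Fin p₁ → ℝ) × (Fin p₂ → ℝ)) (ε : ℝ) :
    MeasurableSet (alignedSamples X Z k π₀ β ε) := by
  refine (measurableSet_singleton 0).union (Finset.measurableSet_biUnion _ fun π _ => ?_)
  exact measurableSet_le (by fun_prop) (by fun_prop)

lemma measureReal_closePairs {γ : ℝ} (hγ0 : 0 ≤ γ) (hγ1 : γ < 1)
    {u : EuclideanSpace ℝ (Fin n)} (hu : u ≠ 0) :
    (stdGaussian (EuclideanSpace ℝ (Fin n))).real {v | (u, v) ∈ closePairs n γ} =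
      coneProb (EuclideanSpace ℝ (Fin (n - 1))) (γ / √(1 - γ ^ 2)) := by
  have h := measureReal_angle_eq (S := ⊤) (Submodule.mem_top (x := u)) hu hγ0 hγ1
  rw [finrank_top, finrank_euclideanSpace_fin] at h
  have htop : ∀ v : EuclideanSpace ℝ (Fin n),
      (⊤ : Submodule ℝ (EuclideanSpace ℝ (Fin n))).starProjection v = v := fun v =>
    Submodule.starProjection_eq_self_iff.mpr Submodule.mem_top
  simp_rw [htop] at h
  exact h

lemma closePairs_swap {γ : ℝ} {u v : EuclideanSpace ℝ (Fin n)} :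
    (u, v) ∈ closePairs n γ ↔ (v, u) ∈ closePairs n γ := by
  simp only [closePairs, Set.mem_ofPred_eq, real_inner_comm, mul_comm]

lemma measureReal_alignedSamples_le {k : ℕ} {π₀ : Equiv.Perm (Fin n)}
    {β : (Fin p₁ → ℝ) × (Fin p₂ → ℝ)} {ε : ℝ} (hn : p₁ + p₂ + 1 < n) (hε0 : 0 ≤ ε)
    (hε1 : ε < 1) (hr : ε / √(1 - ε ^ 2) ≤ 1)
    (hgap : ∀ π ∈ sparsePerms n k, π ≠ π₀ → signalGap X Z π₀ β π ≠ 0) :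
    (stdGaussian (EuclideanSpace ℝ (Fin n))).real (alignedSamples X Z k π₀ β ε) ≤
      (sparsePerms n k).card * (ε / √(1 - ε ^ 2)) ^ (n - (p₁ + p₂) - 1) := by
  have : Nonempty (Fin n) := ⟨⟨0, by omega⟩⟩
  have h0 : (stdGaussian (EuclideanSpace ℝ (Fin n))).real {0} = 0 := by
    rw [measureReal_def, ENNReal.toReal_eq_zero_iff]
    left
    exact measure_eq_zero_iff_ae_notMem.mpr (by simpa using stdGaussian_ae_ne_zero)
  refine (measureReal_union_le _ _).trans ?_
  rw [h0, zero_add]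
  refine (measureReal_biUnion_finset_le _ _).trans ?_
  refine (Finset.sum_le_card_nsmul _ _ ((ε / √(1 - ε ^ 2)) ^ (n - (p₁ + p₂) - 1)) ?_).trans ?_
  · intro π hπ
    rw [Finset.mem_erase] at hπ
    set S := colSpace (design X Z π) with hS
    -- Only W(Π₀) is assumed to have full rank. A rank deficiency of W(Π) enlarges the complement,
    -- which only helps since the tangent is at most 1.
    have hfin : n - (p₁ + p₂) ≤ Module.finrank ℝ Sᗮ := by
      have h1 := S.finrank_add_finrank_orthogonal
      have h2 : Module.finrank ℝ S ≤ p₁ + p₂ := by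
        rw [hS, finrank_colSpace]
        exact (Matrix.rank_le_card_width _).trans_eq (by simp)
      rw [finrank_euclideanSpace_fin] at h1
      omega
    have hmem : signalGap X Z π₀ β π ∈ Sᗮ := by
      rw [signalGap_eq]
      exact Sᗮ.starProjection_apply_mem _
    refine (measureReal_angle_le hmem (hgap π hπ.2 hπ.1) hε0 hε1 (by omega)).trans ?_
    exact pow_le_pow_of_le_one (by positivity) hr (by omega)
  · rw [nsmul_eq_mul]
    gcongr
    exact Finset.erase_subset _ _

lemma mul_cMin_le_norm_sq_signalGap {k : ℕ} {π₀ π : Equiv.Perm (Fin n)}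
    {β : (Fin p₁ → ℝ) × (Fin p₂ → ℝ)} (hn : 0 < n) (hc : 0 ≤ cMin X Z k π₀ β)
    (hπ : π ∈ sparsePerms n k) (hne : π ≠ π₀) :
    n * cMin X Z k π₀ β ≤ ‖signalGap X Z π₀ β π‖ ^ 2 := by
  have h : cMin X Z k π₀ β ≤ ‖signalGap X Z π₀ β π‖ ^ 2 /
      (n * max ((hammingId π₀ : ℝ) - hammingId π) 1) :=
    ciInf_le (Set.finite_range _).bddBelow
      (⟨π, hπ, hne⟩ : {π : Equiv.Perm (Fin n) // π ∈ sparsePerms n k ∧ π ≠ π₀})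
  have hn' : (0 : ℝ) < n := by exact_mod_cast hn
  have hmax : (1 : ℝ) ≤ max ((hammingId π₀ : ℝ) - hammingId π) 1 := le_max_right _ _
  rw [le_div_iff₀ (by positivity)] at h
  refine le_trans ?_ h
  rw [mul_comm]
  exact mul_le_mul_of_nonneg_left (le_mul_of_one_le_right hn'.le hmax) hc

end AlignedSamples

/-! ### The finite-L coverage bound. -/

section Miscoverage

lemma log_exp_div_pos {γ : ℝ} (hγ0 : 0 < γ) (hγ1 : γ ≤ 1) :
    0 < Real.log (Real.exp 1 / γ) := by
  rw [Real.log_div (Real.exp_ne_zero _) hγ0.ne', Real.log_exp]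
  have := Real.log_nonpos hγ0.le hγ1
  linarith

lemma mul_log_exp_div_le_one {γ : ℝ} (hγ0 : 0 < γ) : γ * Real.log (Real.exp 1 / γ) ≤ 1 := by
  have h := Real.log_le_sub_one_of_pos (inv_pos.mpr hγ0)
  rw [Real.log_inv] at h
  rw [Real.log_div (Real.exp_ne_zero _) hγ0.ne', Real.log_exp]
  calc γ * (1 - Real.log γ) ≤ γ * γ⁻¹ := by gcongr; linarith
    _ = 1 := mul_inv_cancel₀ hγ0.ne'

/-- For a sine x/2 ≤ 1/2 the cosine is at least 1/2, so the tangent is at most x. Halving the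
exponent is a pure loss, made to match Δ. -/
lemma tangent_pow_le {x : ℝ} (hx0 : 0 < x) (hx1 : x ≤ 1) {n p : ℕ} (hn : p + 1 < n) :
    (x / 2 / √(1 - (x / 2) ^ 2)) ≤ 1 ∧
    (x / 2 / √(1 - (x / 2) ^ 2)) ^ (n - p - 1) ≤ x ^ (((n : ℝ) - p - 1) / 2) := by
  have h1 : (1 : ℝ) / 2 ≤ √(1 - (x / 2) ^ 2) := Real.le_sqrt_of_sq_le (by nlinarith)
  have h2 : x / 2 / √(1 - (x / 2) ^ 2) ≤ x := by
    rw [div_le_iff₀ (by linarith)]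
    nlinarith
  refine ⟨h2.trans hx1, ?_⟩
  have hcast : ((n - p - 1 : ℕ) : ℝ) = (n : ℝ) - p - 1 := by
    rw [Nat.cast_sub (by omega), Nat.cast_sub (by omega), Nat.cast_one]
  have hpos : 0 ≤ (n : ℝ) - p - 1 := by rw [← hcast]; positivity
  calc (x / 2 / √(1 - (x / 2) ^ 2)) ^ (n - p - 1) ≤ x ^ (n - p - 1) := by gcongr
    _ = x ^ ((n : ℝ) - p - 1) := by rw [← hcast, Real.rpow_natCast]
    _ ≤ x ^ (((n : ℝ) - p - 1) / 2) := Real.rpow_le_rpow_of_exponent_ge hx0 hx1 (by linarith)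

/-- Much of Δ is slack: only the second exponential of the term m = n is kept, whose coefficient is
1 because there is one derangement of the empty set, and the power of π/2 is at least 1. -/
lemma le_deltaGamma {n k p : ℕ} {c σ γ : ℝ} (hγ0 : 0 < γ) (hγ1 : γ ≤ 1) :
    Real.exp (-((n : ℝ) / 2) *
        psi (max 1 (c * Real.log (Real.exp 1 / γ) ^ 2 / (16 * σ ^ 2)))) +
      (sparsePerms n k).card * (γ * Real.log (Real.exp 1 / γ)) ^ (((n : ℝ) - p - 1) / 2) ≤
    deltaGamma n k p c σ γ := by
  rw [deltaGamma]
  refine add_le_add ?_ ?_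
  · refine le_trans ?_ (Finset.single_le_sum (f := fun m : ℕ => (n.choose m : ℝ) *
      (numDerangements (n - m) : ℝ) * (Real.exp (-((n : ℝ) / 2) *
        psi (max 1 (c * Real.log (Real.exp 1 / γ) / (2 * σ ^ 2 * γ)))) +
      Real.exp (-((n : ℝ) / 2) *
        psi (max 1 (c * Real.log (Real.exp 1 / γ) ^ 2 / (16 * σ ^ 2))))))
      (fun m _ => by positivity) (Finset.mem_Icc.mpr ⟨Nat.sub_le n k, le_rfl⟩))
    simp only [Nat.choose_self, Nat.sub_self, numDerangements_zero, Nat.cast_one, one_mul]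
    exact le_add_of_nonneg_left (Real.exp_pos _).le
  · have hlog := log_exp_div_pos hγ0 hγ1
    have hpi : (1 : ℝ) ≤ (Real.pi / 2) ^ (n - p - 2) :=
      one_le_pow₀ (by have := Real.two_le_pi; linarith)
    rw [mul_assoc]
    exact le_mul_of_one_le_left (by positivity) hpi

lemma gammaL_pos {n L : ℕ} (hn : 2 ≤ n) (hL : 1 ≤ L) : 0 < gammaL n L := by
  have h1 : (0 : ℝ) < (n : ℝ) - 1 := by
    have : (2 : ℝ) ≤ n := by exact_mod_cast hn
    linarith
  have h2 : (1 : ℝ) ≤ L := by exact_mod_cast hL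
  have h3 : 0 < Real.log (Real.exp 1 * L) := by
    rw [Real.log_mul (Real.exp_ne_zero _) (by positivity), Real.log_exp]
    have := Real.log_nonneg h2
    linarith
  refine lt_min (by norm_num) (Real.rpow_pos_of_pos (by positivity) _)

variable {n p₁ p₂ k : ℕ} (X : Matrix (Fin n) (Fin p₁) ℝ) (Z : Matrix (Fin n) (Fin p₂) ℝ)

lemma mem_jointConfidenceSet_of_event {L : ℕ} {π₀ : Equiv.Perm (Fin n)}
    {β : (Fin p₁ → ℝ) × (Fin p₂ → ℝ)} {σ α γ : ℝ} (hσ : 0 < σ) (hγ0 : 0 < γ) (hγ1 : γ ≤ 1)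
    (hn : 0 < n) (hπ₀ : π₀ ∈ sparsePerms n k) (hc : 0 < cMin X Z k π₀ β)
    {us : Fin L → EuclideanSpace ℝ (Fin n)} {v : EuclideanSpace ℝ (Fin n)}
    {πhat : Fin L → Equiv.Perm (Fin n)}
    (hT : jointStat X Z (signal X Z π₀ β + σ • v) π₀ β ≤
        quantile (fDist (p₁ + p₂) (n - (p₁ + p₂))) α)
    (hv : ‖v‖ ^ 2 < n * (cMin X Z k π₀ β * Real.log (Real.exp 1 / γ) ^ 2 / (16 * σ ^ 2)))
    {ℓ : Fin L} (hclose : (us ℓ, v) ∈ closePairs n γ)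
    (hgood : us ℓ ∉ alignedSamples X Z k π₀ β (γ * Real.log (Real.exp 1 / γ) / 2))
    (hhat : ∀ ℓ, πhat ℓ ∈ reproArgmin X Z k (signal X Z π₀ β + σ • v) (us ℓ)) :
    β ∈ jointConfidenceSet X Z α (candidateSet k πhat) (signal X Z π₀ β + σ • v) := by
  have hlog := log_exp_div_pos hγ0 hγ1
  have hle := mul_log_exp_div_le_one hγ0
  have heq : πhat ℓ = π₀ := by
    refine eq_of_mem_reproArgmin X Z hσ.le hγ0.le (by positivity) (by linarith) hπ₀ hclose hgood ?_
      (hhat ℓ)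
    intro π hπ hne
    have hgap := mul_cMin_le_norm_sq_signalGap X Z hn hc.le hπ hne
    -- The 16 in the noise threshold is 4 · 2²: the factor 2 of the separation and the 1/2 in ε,
    -- both squared.
    refine lt_of_pow_lt_pow_left₀ 2 (by positivity) ?_
    calc (2 * (σ * (γ * ‖v‖))) ^ 2 = 4 * σ ^ 2 * γ ^ 2 * ‖v‖ ^ 2 := by ring
      _ < 4 * σ ^ 2 * γ ^ 2 *
          (n * (cMin X Z k π₀ β * Real.log (Real.exp 1 / γ) ^ 2 / (16 * σ ^ 2))) := by gcongr
      _ = (γ * Real.log (Real.exp 1 / γ) / 2) ^ 2 * (n * cMin X Z k π₀ β) := by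
          field_simp; ring
      _ ≤ (γ * Real.log (Real.exp 1 / γ) / 2) ^ 2 * ‖signalGap X Z π₀ β π‖ ^ 2 := by gcongr
      _ = _ := by ring
  simp only [jointConfidenceSet, Set.mem_iUnion]
  exact ⟨π₀, ⟨hπ₀, ℓ, heq⟩, hT⟩

/-- For n ≤ 2 both designs would have no columns, so the signal and hence C would vanish. The lower
cone bound in dimension n − 1 needs n ≥ 3. -/
lemma three_le_of_cMin_pos {π₀ : Equiv.Perm (Fin n)} {β : (Fin p₁ → ℝ) × (Fin p₂ → ℝ)}
    (hn : p₁ + p₂ + 1 < n) (hc : 0 < cMin X Z k π₀ β) : 3 ≤ n := by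
  by_contra h
  obtain rfl : p₁ = 0 := by omega
  obtain rfl : p₂ = 0 := by omega
  have h0 : signal X Z π₀ β = 0 := by
    ext i
    simp [signal, Matrix.mulVec, dotProduct]
  simp [cMin, h0] at hc

lemma sub_deltaL_le_measureReal {π₀ : Equiv.Perm (Fin n)} {β₀ : (Fin p₁ → ℝ) × (Fin p₂ → ℝ)}
    {σ₀ α : ℝ} (hα : α ∈ Set.Ioo (0 : ℝ) 1) (hσ : 0 < σ₀) (hπ₀ : π₀ ∈ sparsePerms n k)
    (hrank : (design X Z π₀).rank = p₁ + p₂) (hn : p₁ + p₂ + 1 < n) (hn3 : 3 ≤ n)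
    (hc : 0 < cMin X Z k π₀ β₀) {L : ℕ} (hL : 2 ≤ L) {Ω : Type*} [MeasurableSpace Ω]
    (P : Measure Ω) [IsProbabilityMeasure P]
    {Us : Fin L → Ω → EuclideanSpace ℝ (Fin n)} {U : Ω → EuclideanSpace ℝ (Fin n)}
    {Y : Ω → EuclideanSpace ℝ (Fin n)} {πhat : Fin L → Ω → Equiv.Perm (Fin n)}
    (hlaw : HasLaw (fun ω => ((fun ℓ => Us ℓ ω), U ω))
      ((Measure.pi fun _ : Fin L => stdGaussian (EuclideanSpace ℝ (Fin n))).prod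
        (stdGaussian (EuclideanSpace ℝ (Fin n)))) P)
    (hY : ∀ ω, Y ω = signal X Z π₀ β₀ + σ₀ • U ω)
    (hhat : ∀ ℓ ω, πhat ℓ ω ∈ reproArgmin X Z k (Y ω) (Us ℓ ω)) :
    α - deltaL n k (p₁ + p₂) (cMin X Z k π₀ β₀) σ₀ L ≤
      P.real {ω | β₀ ∈ jointConfidenceSet X Z α (candidateSet k fun ℓ => πhat ℓ ω) (Y ω)} := by
  set ν : Measure (EuclideanSpace ℝ (Fin n)) := stdGaussian (EuclideanSpace ℝ (Fin n)) with hν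
  set c := cMin X Z k π₀ β₀ with hcdef
  set γ := gammaL n L with hγ
  have hγ0 : 0 < γ := gammaL_pos (by omega) (by omega)
  have hγ4 : γ ≤ 1 / 4 := min_le_left _ _
  have hγ1 : γ < 1 := by linarith
  set x := γ * Real.log (Real.exp 1 / γ) with hx
  have hx0 : 0 < x := mul_pos hγ0 (log_exp_div_pos hγ0 hγ1.le)
  have hx1 : x ≤ 1 := mul_log_exp_div_le_one hγ0
  have hne : Nonempty (Fin n) := ⟨⟨0, by omega⟩⟩
  obtain ⟨htan, hpow⟩ := tangent_pow_le hx0 hx1 hn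
  set q := coneProb (EuclideanSpace ℝ (Fin (n - 1))) (γ / √(1 - γ ^ 2)) with hq
  set A : Set (EuclideanSpace ℝ (Fin n)) := {v | jointStat X Z (signal X Z π₀ β₀ + σ₀ • v) π₀ β₀ ≤
    quantile (fDist (p₁ + p₂) (n - (p₁ + p₂))) α} with hA
  set B : Set (EuclideanSpace ℝ (Fin n)) :=
    {v | n * (c * Real.log (Real.exp 1 / γ) ^ 2 / (16 * σ₀ ^ 2)) ≤ ‖v‖ ^ 2} with hB
  set D : Set ((Fin L → EuclideanSpace ℝ (Fin n)) × EuclideanSpace ℝ (Fin n)) :=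
    {p | ∀ ℓ, ¬ ((p.1 ℓ, p.2) ∈ closePairs n γ ∧
      p.1 ℓ ∉ alignedSamples X Z k π₀ β₀ (x / 2))} with hD
  have hAm : MeasurableSet A :=
    measurableSet_le ((measurable_jointStat X Z π₀ β₀).comp (by fun_prop)) measurable_const
  have hBm : MeasurableSet B := measurableSet_le measurable_const (by fun_prop)
  have hDm : MeasurableSet D := by
    rw [hD, Set.ofPred_forall]
    refine MeasurableSet.iInter fun ℓ => MeasurableSet.compl (MeasurableSet.inter ?_ ?_)
    · exact (measurableSet_closePairs n γ).preimage
        (f := fun p : (Fin L → EuclideanSpace ℝ (Fin n)) × EuclideanSpace ℝ (Fin n) =>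
          (p.1 ℓ, p.2)) (by fun_prop)
    · exact (measurableSet_alignedSamples X Z k π₀ β₀ (x / 2)).compl.preimage
        (f := fun p : (Fin L → EuclideanSpace ℝ (Fin n)) × EuclideanSpace ℝ (Fin n) =>
          p.1 ℓ) (by fun_prop)
  have hPA : α ≤ ν.real A := le_measureReal_jointStat_le X Z hσ.ne' hα (by omega) hrank
  have hPB : ν.real B ≤ Real.exp (-((n : ℝ) / 2) *
      psi (max 1 (c * Real.log (Real.exp 1 / γ) ^ 2 / (16 * σ₀ ^ 2)))) := by
    have := stdGaussian_norm_sq_ge_le (E := EuclideanSpace ℝ (Fin n))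
      (c * Real.log (Real.exp 1 / γ) ^ 2 / (16 * σ₀ ^ 2))
    rwa [finrank_euclideanSpace_fin] at this
  have hqlow : γ ^ (n - 1) / ((n : ℝ) - 1) ≤ q := by
    have := le_coneProb_sine (d := n - 1) (by omega) hγ0.le hγ1
    rwa [Nat.cast_sub (by omega), Nat.cast_one] at this
  have hn1 : (0 : ℝ) < (n : ℝ) - 1 := by
    have : (3 : ℝ) ≤ n := by exact_mod_cast hn3
    linarith
  have hq0 : 0 < q := lt_of_lt_of_le (by positivity) hqlow
  have hq1 : q ≤ 1 := measureReal_le_one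
  have hgap : ∀ π ∈ sparsePerms n k, π ≠ π₀ → signalGap X Z π₀ β₀ π ≠ 0 := by
    intro π hπ hπne h0
    have := mul_cMin_le_norm_sq_signalGap X Z (by omega) hc.le hπ hπne
    rw [h0, norm_zero, zero_pow two_ne_zero] at this
    exact absurd this (not_le.mpr (mul_pos (by linarith) hc))
  have hPD : ((Measure.pi fun _ : Fin L => ν).prod ν).real D ≤
      (1 - γ ^ (n - 1) / ((n : ℝ) - 1)) ^ L +
        (sparsePerms n k).card * x ^ (((n : ℝ) - (p₁ + p₂ : ℕ) - 1) / 2) := by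
    have hcl : ∀ᵐ u ∂ν, ν.real {v | (u, v) ∈ closePairs n γ} = q := by
      filter_upwards [stdGaussian_ae_ne_zero (E := EuclideanSpace ℝ (Fin n))] with u hu
      exact measureReal_closePairs hγ0.le hγ1 hu
    have hcl' : ∀ᵐ v ∂ν, ν.real {u | (u, v) ∈ closePairs n γ} = q := by
      filter_upwards [hcl] with v hv
      rw [← hv]
      congr 1
      ext u
      exact closePairs_swap
    refine (measureReal_no_good_close_le ν (measurableSet_closePairs n γ)
      (measurableSet_alignedSamples X Z k π₀ β₀ (x / 2)) hq0
      hcl' hcl L).trans ?_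
    refine add_le_add (pow_le_pow_left₀ (by linarith) (by linarith) _) ?_
    refine (measureReal_alignedSamples_le X Z hn (by positivity) (by linarith) htan hgap).trans ?_
    gcongr
  have hΔ := le_deltaGamma (n := n) (k := k) (p := p₁ + p₂) (c := c) (σ := σ₀) hγ0 hγ1.le
  -- The minimizers carry no measurability assumption, so the coverage event need not be measurable;
  -- it is bounded below through this measurable event in the samples and the noise.
  set G : Set ((Fin L → EuclideanSpace ℝ (Fin n)) × EuclideanSpace ℝ (Fin n)) :=
    Prod.snd ⁻¹' A \ (Prod.snd ⁻¹' B ∪ D) with hG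
  have hGm : MeasurableSet G :=
    (hAm.preimage measurable_snd).diff ((hBm.preimage measurable_snd).union hDm)
  have hsnd : ∀ s : Set (EuclideanSpace ℝ (Fin n)), MeasurableSet s →
      ((Measure.pi fun _ : Fin L => ν).prod ν).real (Prod.snd ⁻¹' s) = ν.real s := by
    intro s hs
    rw [← map_measureReal_apply measurable_snd hs, Measure.map_snd_prod]
    simp
  have hPG : α - deltaL n k (p₁ + p₂) c σ₀ L ≤
      ((Measure.pi fun _ : Fin L => ν).prod ν).real G := by
    have h1 := le_measureReal_sdiff (μ := (Measure.pi fun _ : Fin L => ν).prod ν)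
      (s₁ := Prod.snd ⁻¹' A) (s₂ := Prod.snd ⁻¹' B ∪ D)
    have h2 := measureReal_union_le (μ := (Measure.pi fun _ : Fin L => ν).prod ν)
      (Prod.snd ⁻¹' B) D
    rw [hsnd B hBm] at h2
    rw [hsnd A hAm] at h1
    rw [deltaL]
    linarith
  refine hPG.trans ((hlaw.measureReal_eq (p := fun p => p ∈ G) hGm).symm.le.trans ?_)
  refine measureReal_mono fun ω hω => ?_
  obtain ⟨hωA, hωBD⟩ := hω
  rw [Set.mem_union, not_or] at hωBD
  obtain ⟨hωB, hωD⟩ := hωBD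
  have hωD' : ∃ ℓ, (Us ℓ ω, U ω) ∈ closePairs n γ ∧
      Us ℓ ω ∉ alignedSamples X Z k π₀ β₀ (x / 2) := by
    by_contra hcon
    exact hωD (not_exists.mp hcon)
  obtain ⟨ℓ, hℓ1, hℓ2⟩ := hωD'
  have hmin : ∀ ℓ, πhat ℓ ω ∈ reproArgmin X Z k (signal X Z π₀ β₀ + σ₀ • U ω) (Us ℓ ω) :=
    fun ℓ => hY ω ▸ hhat ℓ ω
  have hmain := mem_jointConfidenceSet_of_event X Z hσ hγ0 hγ1.le (by omega) hπ₀ hc hωA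
    (not_le.mp hωB) (us := fun ℓ => Us ℓ ω) hℓ1 hℓ2 hmin
  rw [← hY ω] at hmain
  exact hmain

end Miscoverage

/-! ### The rate as L grows, in terms of t = log L. -/

section Asymptotics

lemma half_sub_one_le_psi {y : ℝ} (hy : 0 < y) : y / 2 - 1 ≤ psi y := by
  have h1 := Real.log_le_sub_one_of_pos (half_pos hy)
  rw [Real.log_div hy.ne' two_ne_zero] at h1
  have h2 : Real.log 2 < 1 := Real.log_two_lt_d9.trans (by norm_num)
  rw [psi]; linarith

/-- Ψ grows at least like y/2 − 1, and κt² ≥ 4t, so Ψ ≥ 2t − 1 ≥ t. -/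
lemma exp_neg_psi_le {n : ℕ} (hn : 2 ≤ n) {κ t y : ℝ} (hκ : 0 < κ) (ht1 : 1 ≤ t)
    (ht2 : 4 / κ ≤ t) (hy : κ * t ^ 2 ≤ y) :
    Real.exp (-((n : ℝ) / 2) * psi (max 1 y)) ≤ Real.exp (-t) := by
  have h1 := half_sub_one_le_psi (lt_of_lt_of_le one_pos (le_max_left 1 y))
  have h2 : κ * t ^ 2 ≤ max 1 y := hy.trans (le_max_right _ _)
  have h3 : 4 ≤ κ * t := by rwa [div_le_iff₀' hκ] at ht2
  have h4 : t ≤ psi (max 1 y) := by nlinarith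
  have h5 : (1 : ℝ) ≤ n / 2 := by
    have : (2 : ℝ) ≤ n := by exact_mod_cast hn
    linarith
  apply Real.exp_le_exp.mpr
  nlinarith

lemma mul_one_add_le_exp {M t : ℝ} (ht1 : 1 ≤ t) (ht : 4 * M ≤ t) :
    M * (1 + t) ≤ Real.exp t := by
  have := Real.quadratic_le_exp_of_nonneg (show 0 ≤ t by linarith)
  nlinarith

lemma mul_one_add_le_exp_half {M t : ℝ} (ht1 : 1 ≤ t) (ht : 16 * M ≤ t) :
    M * (1 + t) ≤ Real.exp (t / 2) := by
  have := Real.quadratic_le_exp_of_nonneg (show 0 ≤ t / 2 by linarith)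
  nlinarith

section

variable {n L : ℕ} {t : ℝ}

/-- The threshold on t gives (n − 1)(1 + t)/L ≤ 4^(−(n − 1)), so the cap 1/4 in γ_L is inactive. -/
lemma gammaL_eq (hn : 2 ≤ n) (hL : 0 < L) (ht : t = Real.log L) (ht1 : 1 ≤ t)
    (ht2 : 4 * (((n : ℝ) - 1) * 4 ^ ((n : ℝ) - 1)) ≤ t) :
    gammaL n L = (((n : ℝ) - 1) * (1 + t) / L) ^ (1 / ((n : ℝ) - 1)) := by
  have hN : (0 : ℝ) < (n : ℝ) - 1 := by
    have : (2 : ℝ) ≤ n := by exact_mod_cast hn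
    linarith
  have hL0 : (0 : ℝ) < L := by exact_mod_cast hL
  have hlog : Real.log (Real.exp 1 * L) = 1 + t := by
    rw [Real.log_mul (Real.exp_ne_zero _) hL0.ne', Real.log_exp, ht]
  have hexp : Real.exp t = L := by rw [ht, Real.exp_log hL0]
  rw [gammaL, hlog, min_eq_right]
  have h1 := mul_one_add_le_exp ht1 ht2
  rw [hexp] at h1
  have h2 : ((n : ℝ) - 1) * (1 + t) / L ≤ (1 / 4) ^ ((n : ℝ) - 1) := by
    rw [div_le_iff₀ hL0, one_div, Real.inv_rpow (by norm_num), inv_mul_eq_div,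
      le_div_iff₀ (by positivity)]
    linarith
  calc (((n : ℝ) - 1) * (1 + t) / L) ^ (1 / ((n : ℝ) - 1))
      ≤ ((1 / 4) ^ ((n : ℝ) - 1)) ^ (1 / ((n : ℝ) - 1)) := by gcongr
    _ = 1 / 4 := by
        rw [← Real.rpow_mul (by norm_num), mul_one_div_cancel hN.ne', Real.rpow_one]

lemma log_exp_div_gammaL (hn : 2 ≤ n) (hL : 0 < L) (ht : t = Real.log L) (ht1 : 1 ≤ t)
    (ht2 : 4 * (((n : ℝ) - 1) * 4 ^ ((n : ℝ) - 1)) ≤ t) :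
    Real.log (Real.exp 1 / gammaL n L) =
      1 + (t - Real.log (((n : ℝ) - 1) * (1 + t))) / ((n : ℝ) - 1) := by
  have hN : (0 : ℝ) < (n : ℝ) - 1 := by
    have : (2 : ℝ) ≤ n := by exact_mod_cast hn
    linarith
  have hL0 : (0 : ℝ) < L := by exact_mod_cast hL
  rw [Real.log_div (Real.exp_ne_zero _) (gammaL_pos hn hL).ne', Real.log_exp,
    gammaL_eq hn hL ht ht1 ht2, Real.log_rpow (by positivity), Real.log_div (by positivity) hL0.ne',
    ← ht]
  ring

lemma one_sub_gammaL_pow_le (hn : 2 ≤ n) (hL : 0 < L) (ht : t = Real.log L) (ht1 : 1 ≤ t)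
    (ht2 : 4 * (((n : ℝ) - 1) * 4 ^ ((n : ℝ) - 1)) ≤ t) :
    0 ≤ (1 - gammaL n L ^ (n - 1) / ((n : ℝ) - 1)) ^ L ∧
    (1 - gammaL n L ^ (n - 1) / ((n : ℝ) - 1)) ^ L ≤ Real.exp (-t) := by
  have hN1 : (1 : ℝ) ≤ (n : ℝ) - 1 := by
    have : (2 : ℝ) ≤ n := by exact_mod_cast hn
    linarith
  have hN : (0 : ℝ) < (n : ℝ) - 1 := by linarith
  have hL0 : (0 : ℝ) < L := by exact_mod_cast hL
  have hγ0 := gammaL_pos hn hL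
  have hγ1 : gammaL n L ≤ 1 := (min_le_left _ _).trans (by norm_num)
  have hle : gammaL n L ^ (n - 1) / ((n : ℝ) - 1) ≤ 1 := by
    rw [div_le_one hN]
    exact (pow_le_one₀ hγ0.le hγ1).trans hN1
  -- γ_L is chosen for this identity: the L-th power is then at most e^(−(1 + t)), of order 1/L.
  have hpow : gammaL n L ^ (n - 1) / ((n : ℝ) - 1) = (1 + t) / L := by
    rw [gammaL_eq hn hL ht ht1 ht2, ← Real.rpow_natCast, ← Real.rpow_mul (by positivity),
      Nat.cast_sub (by omega), Nat.cast_one, one_div_mul_cancel hN.ne', Real.rpow_one]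
    field_simp
  refine ⟨pow_nonneg (by linarith) _, ?_⟩
  calc (1 - gammaL n L ^ (n - 1) / ((n : ℝ) - 1)) ^ L
      ≤ Real.exp (-(gammaL n L ^ (n - 1) / ((n : ℝ) - 1))) ^ L := by
        refine pow_le_pow_left₀ (by linarith) ?_ _
        exact Real.one_sub_le_exp_neg _
    _ = Real.exp (-(1 + t)) := by
        rw [hpow, ← Real.exp_nat_mul]
        congr 1
        field_simp
    _ ≤ Real.exp (-t) := Real.exp_le_exp.mpr (by linarith)

lemma gammaL_mul_log_le (hn : 2 ≤ n) (hL : 0 < L) (ht : t = Real.log L) (ht1 : 1 ≤ t)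
    (ht2 : 4 * (((n : ℝ) - 1) * 4 ^ ((n : ℝ) - 1)) ≤ t) :
    gammaL n L * Real.log (Real.exp 1 / gammaL n L) ≤
      (2 * (2 * ((n : ℝ) - 1)) ^ (1 / ((n : ℝ) - 1))) *
        (t ^ (1 + 1 / ((n : ℝ) - 1)) / (L : ℝ) ^ (1 / ((n : ℝ) - 1))) := by
  have hN1 : (1 : ℝ) ≤ (n : ℝ) - 1 := by
    have : (2 : ℝ) ≤ n := by exact_mod_cast hn
    linarith
  have hN : (0 : ℝ) < (n : ℝ) - 1 := by linarith
  have hL0 : (0 : ℝ) < L := by exact_mod_cast hL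
  have ht0 : 0 < t := by linarith
  have hlog : Real.log (Real.exp 1 / gammaL n L) ≤ 2 * t := by
    rw [log_exp_div_gammaL hn hL ht ht1 ht2]
    have h1 : 0 ≤ Real.log (((n : ℝ) - 1) * (1 + t)) := Real.log_nonneg (by nlinarith)
    have h2 : (t - Real.log (((n : ℝ) - 1) * (1 + t))) / ((n : ℝ) - 1) ≤ t := by
      rw [div_le_iff₀ hN]; nlinarith
    linarith
  have hγ : gammaL n L ≤ (2 * ((n : ℝ) - 1) * t / L) ^ (1 / ((n : ℝ) - 1)) := by
    rw [gammaL_eq hn hL ht ht1 ht2]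
    gcongr ?_ ^ _
    gcongr ?_ / _
    nlinarith
  calc gammaL n L * Real.log (Real.exp 1 / gammaL n L)
      ≤ (2 * ((n : ℝ) - 1) * t / L) ^ (1 / ((n : ℝ) - 1)) * (2 * t) :=
        mul_le_mul hγ hlog (log_exp_div_pos (gammaL_pos hn hL)
          ((min_le_left _ _).trans (by norm_num))).le (by positivity)
    _ = _ := by
        rw [Real.div_rpow (by positivity) hL0.le, Real.mul_rpow (by positivity) ht0.le,
          Real.rpow_add ht0, Real.rpow_one]
        ring

lemma le_log_exp_div_gammaL (hn : 2 ≤ n) (hL : 0 < L) (ht : t = Real.log L) (ht1 : 1 ≤ t)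
    (ht2 : 4 * (((n : ℝ) - 1) * 4 ^ ((n : ℝ) - 1)) ≤ t) (ht3 : 16 * ((n : ℝ) - 1) ≤ t) :
    t / (2 * ((n : ℝ) - 1)) ≤ Real.log (Real.exp 1 / gammaL n L) := by
  have hN : (0 : ℝ) < (n : ℝ) - 1 := by
    have : (2 : ℝ) ≤ n := by exact_mod_cast hn
    linarith
  rw [log_exp_div_gammaL hn hL ht ht1 ht2]
  have h1 : Real.log (((n : ℝ) - 1) * (1 + t)) ≤ t / 2 := by
    rw [Real.log_le_iff_le_exp (by positivity)]
    exact mul_one_add_le_exp_half ht1 ht3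
  have h2 : t / (2 * ((n : ℝ) - 1)) ≤ (t - Real.log (((n : ℝ) - 1) * (1 + t))) / ((n : ℝ) - 1) := by
    rw [mul_comm, ← div_div, div_right_comm]
    gcongr
    linarith
  linarith

end

lemma deltaL_isBigO {n k p : ℕ} {c σ : ℝ} (hn : p + 1 < n) (hc : 0 < c) (hσ : 0 < σ) :
    (fun L : ℕ => deltaL n k p c σ L) =O[atTop]
      (fun L : ℕ => Real.log L ^ (((n : ℝ) - p) / 2) /
        (L : ℝ) ^ (((n : ℝ) - p - 1) / (2 * ((n : ℝ) - 1)))) := by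
  have hn2 : 2 ≤ n := by omega
  have hp : (p : ℝ) + 1 < n := by exact_mod_cast hn
  have hp0 : (0 : ℝ) ≤ p := Nat.cast_nonneg p
  have hN1 : (1 : ℝ) ≤ (n : ℝ) - 1 := by
    have : (2 : ℝ) ≤ n := by exact_mod_cast hn2
    linarith
  set N : ℝ := (n : ℝ) - 1 with hN
  have hN0 : 0 < N := by linarith
  set a : ℝ := ((n : ℝ) - p - 1) / 2 with ha
  have ha0 : 0 < a := by rw [ha]; linarith
  -- This absorbs the extra log power a/N from γ_L into 1/2, giving the exponent (n − p)/2; it also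
  -- makes 1/L negligible against the target.
  have haN : a / N ≤ 1 / 2 := by rw [div_le_iff₀ hN0, ha, hN]; linarith
  -- From log(e/γ) ≥ t/(2N), squared and divided by 16σ².
  set κ : ℝ := c / (64 * σ ^ 2 * N ^ 2) with hκ
  have hκ0 : 0 < κ := by positivity
  set S : ℝ := ∑ m ∈ Finset.Icc (n - k) n, (n.choose m : ℝ) * (numDerangements (n - m) : ℝ) with hS
  have hS0 : 0 ≤ S := Finset.sum_nonneg fun m _ => by positivity
  set K : ℝ := (Real.pi / 2) ^ (n - p - 2) * ((sparsePerms n k).card : ℝ) with hK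
  have hK0 : 0 ≤ K := by positivity
  set Q : ℝ := 2 * (2 * N) ^ (1 / N) with hQ
  have hQ0 : 0 < Q := by positivity
  have hlim : Tendsto (fun L : ℕ => Real.log L) atTop atTop :=
    Real.tendsto_log_atTop.comp tendsto_natCast_atTop_atTop
  refine IsBigO.of_bound (S * 2 + K * Q ^ a + 1) ?_
  filter_upwards [hlim.eventually_ge_atTop 1, hlim.eventually_ge_atTop (4 * (N * 4 ^ N)),
    hlim.eventually_ge_atTop (16 * N), hlim.eventually_ge_atTop (4 / κ), eventually_gt_atTop 0]
    with L h1 h2 h3 h4 hL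
  have hL0 : (0 : ℝ) < L := by exact_mod_cast hL
  have hL1 : (1 : ℝ) ≤ L := by exact_mod_cast hL
  obtain ⟨t, ht⟩ : ∃ t, t = Real.log L := ⟨_, rfl⟩
  rw [← ht] at h1 h2 h3 h4 ⊢
  have ht0 : 0 < t := by linarith
  have hexp : Real.exp (-t) = (L : ℝ)⁻¹ := by rw [Real.exp_neg, ht, Real.exp_log hL0]
  set T : ℝ := t ^ (((n : ℝ) - p) / 2) / (L : ℝ) ^ (((n : ℝ) - p - 1) / (2 * N)) with hT
  have hexpo : ((n : ℝ) - p - 1) / (2 * N) = a / N := by rw [ha, div_div]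
  have hexpo2 : ((n : ℝ) - p) / 2 = a + 1 / 2 := by rw [ha]; ring
  rw [hexpo, hexpo2] at hT
  have hT0 : 0 ≤ T := by rw [hT]; positivity
  have hexpT : Real.exp (-t) ≤ T := by
    rw [hexp, hT, le_div_iff₀ (by positivity), ← Real.rpow_neg_one, ← Real.rpow_add hL0]
    calc (L : ℝ) ^ (-1 + a / N) ≤ 1 := Real.rpow_le_one_of_one_le_of_nonpos hL1 (by linarith)
      _ ≤ t ^ (a + 1 / 2) := Real.one_le_rpow h1 (by linarith)
  obtain ⟨hlast0, hlast⟩ := one_sub_gammaL_pow_le hn2 hL ht h1 h2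
  have hγ0 := gammaL_pos hn2 hL
  have hγ1 : gammaL n L ≤ 1 := (min_le_left _ _).trans (by norm_num)
  have hlg0 := log_exp_div_pos hγ0 hγ1
  have hlg1 := mul_log_exp_div_le_one hγ0
  have hlglow := le_log_exp_div_gammaL hn2 hL ht h1 h2 h3
  have hx := gammaL_mul_log_le hn2 hL ht h1 h2
  rw [deltaL, deltaGamma]
  set γ := gammaL n L
  set lg := Real.log (Real.exp 1 / γ)
  have hy2 : κ * t ^ 2 ≤ c * lg ^ 2 / (16 * σ ^ 2) := by
    calc κ * t ^ 2 = c * (t / (2 * N)) ^ 2 / (16 * σ ^ 2) := by rw [hκ]; field_simp; norm_num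
      _ ≤ c * lg ^ 2 / (16 * σ ^ 2) := by gcongr
  -- The argument of the first exponential dominates that of the second because γ log(e/γ) ≤ 1 ≤ 8.
  have hy1 : κ * t ^ 2 ≤ c * lg / (2 * σ ^ 2 * γ) := by
    refine hy2.trans ?_
    rw [div_le_div_iff₀ (by positivity) (by positivity)]
    have : 0 < c * lg * σ ^ 2 := by positivity
    nlinarith
  have he1 := exp_neg_psi_le hn2 hκ0 h1 h4 hy1
  have he2 := exp_neg_psi_le hn2 hκ0 h1 h4 hy2
  have hxT : (γ * lg) ^ a ≤ Q ^ a * T := by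
    calc (γ * lg) ^ a ≤ (Q * (t ^ (1 + 1 / N) / (L : ℝ) ^ (1 / N))) ^ a := by gcongr
      _ = Q ^ a * (t ^ (a + a / N) / (L : ℝ) ^ (a / N)) := by
          rw [Real.mul_rpow hQ0.le (by positivity), Real.div_rpow (by positivity) (by positivity),
            ← Real.rpow_mul ht0.le, ← Real.rpow_mul hL0.le]
          ring_nf
      _ ≤ Q ^ a * T := by
          rw [hT]
          gcongr
  rw [← Finset.sum_mul, ← hS, ← hK, Real.norm_eq_abs, Real.norm_eq_abs, abs_of_nonneg hT0,
    abs_of_nonneg (by positivity)]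
  calc S * _ + K * (γ * lg) ^ a + _
      ≤ S * (T + T) + K * (Q ^ a * T) + T := by
        gcongr
        · exact he1.trans hexpT
        · exact he2.trans hexpT
        · exact hlast.trans hexpT
    _ = _ := by ring

end Asymptotics
end PermutedRegression

theorem mainTheorem9 {n p₁ p₂ k : ℕ}
    (X : Matrix (Fin n) (Fin p₁) ℝ) (Z : Matrix (Fin n) (Fin p₂) ℝ)
    (π₀ : Equiv.Perm (Fin n)) (β₀ : (Fin p₁ → ℝ) × (Fin p₂ → ℝ)) (σ₀ α : ℝ)
    (hα : α ∈ Set.Ioo (0 : ℝ) 1) (hσ : 0 < σ₀)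
    (hπ₀ : π₀ ∈ sparsePerms n k)
    (hrank : (design X Z π₀).rank = p₁ + p₂)
    (hn : p₁ + p₂ + 1 < n)
    (hc : 0 < cMin X Z k π₀ β₀) :
    (∀ L : ℕ, 2 ≤ L →
      ∀ {Ω : Type*} [MeasurableSpace Ω] (P : Measure Ω) [IsProbabilityMeasure P]
        (Us : Fin L → Ω → EuclideanSpace ℝ (Fin n)) (U : Ω → EuclideanSpace ℝ (Fin n))
        (Y : Ω → EuclideanSpace ℝ (Fin n)) (πhat : Fin L → Ω → Equiv.Perm (Fin n)),
        -- `U₁*, …, U_L*, U` are i.i.d. `N(0, I_n)`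
        HasLaw (fun ω => ((fun ℓ => Us ℓ ω), U ω))
          ((Measure.pi fun _ : Fin L => stdGaussian (EuclideanSpace ℝ (Fin n))).prod
            (stdGaussian (EuclideanSpace ℝ (Fin n)))) P →
        (∀ ω, Y ω = signal X Z π₀ β₀ + σ₀ • U ω) →
        -- `πhat ℓ` is an arbitrary choice of a minimizer
        (∀ ℓ ω, πhat ℓ ω ∈ reproArgmin X Z k (Y ω) (Us ℓ ω)) →
        α - deltaL n k (p₁ + p₂) (cMin X Z k π₀ β₀) σ₀ L ≤
          P.real {ω | β₀ ∈ jointConfidenceSet X Z α (candidateSet k fun ℓ => πhat ℓ ω) (Y ω)}) ∧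
    (fun L : ℕ => deltaL n k (p₁ + p₂) (cMin X Z k π₀ β₀) σ₀ L) =O[atTop]
      (fun L : ℕ => Real.log L ^ (((n : ℝ) - ((p₁ : ℝ) + p₂)) / 2) /
        (L : ℝ) ^ (((n : ℝ) - ((p₁ : ℝ) + p₂) - 1) / (2 * ((n : ℝ) - 1)))) := by
  have hn3 : 3 ≤ n := three_le_of_cMin_pos X Z hn hc
  refine ⟨fun L hL Ω _ P _ Us U Y πhat hlaw hY hhat =>
    sub_deltaL_le_measureReal X Z hα hσ hπ₀ hrank hn hn3 hc hL P hlaw hY hhat, ?_⟩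
  have h := deltaL_isBigO (k := k) hn hc hσ
  push_cast at h
  exact h
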